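/- Let $m,q\ge 1$. For an axis $[x]\in\mathbb{R}P^m$, $x\in\mathbb R^{m+1}$, $x^Tx=1$, put $j([x])=xx^T$, and let $j_k:(\mathbb{R}P^m)^q\to S(m+1)^q$, $j_k([x_1],\dots,[x_q])=(x_1x_1^T,\dots,x_qx_q^T)$, where $S(m+1)$ is the space of symmetric $(m+1)\times(m+1)$ matrices and $S(m+1)^q$ carries the Euclidean (Frobenius) distance. A point $A\in S(m+1)^q$ is nonfocal if a unique point $P(A)$ of $j_k((\mathbb{R}P^m)^q)$ is nearest to $A$. Let $Y_r=([X_r^1],\dots,[X_r^q])$, $(X_r^s)^TX_r^s=1$, $r=1,2,\dots$, be i.i.d. random points of $(\mathbb{R}P^m)^q$ such that $\mu=E(j_k(Y_1))$ is nonfocal, and let $\mu_{j_k}=j_k^{-1}(P(\mu))$ be their extrinsic mean. Let $\gamma_s(1),\dots,\gamma_s(m+1)$ be orthonormal eigenvectors of $\mu_s=E(X_1^s(X_1^s)^T)$, with the eigenvalues in increasing order. For $s\le q$, $a\le m$ let $e_{(s,a)}\in S(m+1)^q$ have $s$-th component $\gamma_s(a)\gamma_s(m+1)^T+\gamma_s(m+1)\gamma_s(a)^T$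 and all other components $0$; these vectors are orthonormal for the scalar product $(A,B)\mapsto\frac12\sum_s\mathrm{tr}(A_sB_s)$. Assume that the extrinsic covariance matrix $\Sigma_E$, the $mq\times mq$ covariance matrix of the coordinates of $d_\mu P(j_k(Y_1))$ along the $e_{(s,a)}$, is positive definite. For $n\ge1$ and $s=1,\dots,q$ let $d_s(1)\le\dots\le d_s(m+1)$ and $g_s(1),\dots,g_s(m+1)$ be the eigenvalues and corresponding orthonormal eigenvectors of $J_s=n^{-1}\sum_{r=1}^nX_r^s(X_r^s)^T$, so that $\overline Y_{j_k,n}=([g_1(m+1)],\dots,[g_q(m+1)])$; let $D_s=(g_s(1),\dots,g_s(m))$ and let $G_n$ be the $mq\times mq$ matrix with entries $$(G_n)_{(s,a),(t,b)}=n^{-1}(d_s(m+1)-d_s(a))^{-1}(d_t(m+1)-d_t(b))^{-1}\sum_{r=1}^n(g_s(a)^TX_r^s)(g_t(b)^TX_r^t)(g_s(m+1)^TX_r^s)(g_t(m+1)^TX_r^t).$$ For $\mu_0=([\gamma_1],\dots,[\gamma_q])$, $\gamma_s^T\gamma_s=1$, with the signs chosen so that $\gamma_s^Tg_s(m+1)\ge0$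 for all $s$, let $$T(\overline Y_{j_k,n};\mu_0)=n(\gamma_1^TD_1,\dots,\gamma_q^TD_q)\,G_n^{-1}\,(\gamma_1^TD_1,\dots,\gamma_q^TD_q)^T .$$ ($T$ is defined as soon as the $d_s(m+1)$ are simple and $G_n$ is invertible; on the remaining event it may be given any fixed conventional value, here the one with $0^{-1}=0$ and $G_n^{-1}=0$ for singular $G_n$.) Then, for the testing problem $H_0:\mu_{j_k}=\mu_0$ against $H_1:\mu_{j_k}\ne\mu_0$, $$p_n=\Pr\bigl(T>T(\overline Y_{j_k,n};\mu_0)\bigr),\qquad T\sim\chi^2_{mq}\ \text{independent of the data},$$ is a large sample p-value, in the following sense. 1. Under $H_0$, the probability that $T(\overline Y_{j_k,n};\mu_0)$ exceeds $t$ converges to $\Pr(T>t)$ as $n\to\infty$, uniformly in $t\in\mathbb R$; and $\Pr(p_n\le\alpha)\to\alpha$ for every $\alpha\in[0,1]$. 2. Under $H_1$, $\Pr(p_n\le\alpha)\to1$ for every $\alpha>0$. (The eigenvectors may be chosen in any way, measurable or not; probabilities of sets that are not measurable are outer probabilities.) -/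

import Mathlib

open MeasureTheory ProbabilityTheory Filter Topology
open scoped RealInnerProductSpace Matrix

noncomputable section

namespace ProjShape

/-- `ℝ^(m+1)` with its Euclidean inner product. -/
abbrev Vec (m : ℕ) := EuclideanSpace ℝ (Fin (m + 1))

/-- The real projective space `ℝP^m` of axes `[x]`, `x ∈ ℝ^(m+1) \ {0}`. -/
abbrev RP (m : ℕ) := Projectivization ℝ (Vec m)

/-- The quotient topology on `ℝP^m`. -/
instance instTopologicalSpaceRP (m : ℕ) : TopologicalSpace (RP m) :=
  inferInstanceAs (TopologicalSpace (Quotient (projectivizationSetoid ℝ (Vec m))))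

/-- The Borel σ-algebra on `ℝP^m`; products `(ℝP^m)^q` carry the product σ-algebra. -/
instance instMeasurableSpaceRP (m : ℕ) : MeasurableSpace (RP m) := borel (RP m)

instance instBorelSpaceRP (m : ℕ) : BorelSpace (RP m) := ⟨rfl⟩

/-- The space `(ℝP^m)^q` of projective shapes in multi-axial representation. -/
abbrev Axes (m q : ℕ) := Fin q → RP m

/-- `x` is a unit vector spanning the axis `p`, i.e. `p = [x]` and `xᵀ x = 1`. -/
def IsUnitRep {m : ℕ} (x : Vec m) (p : RP m) : Prop := ‖x‖ = 1 ∧ x ∈ p.submodule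

/-- A chosen unit vector spanning the axis `p`. -/
def unitRep {m : ℕ} (p : RP m) : Vec m := ‖p.rep‖⁻¹ • p.rep

/-- The space `S(m+1)^q` of `q`-tuples `A = (A_1, …, A_q)` of symmetric matrices. The entry `(i, j)`
of `A_s` is `A (s, i, j)`, and the Euclidean inner product is `⟪A, B⟫ = ∑ₛ tr (Aₛ Bₛ)`. -/
def SymTuple (m q : ℕ) : Submodule ℝ (EuclideanSpace ℝ (Fin q × Fin (m + 1) × Fin (m + 1))) where
  carrier := {A | ∀ s i j, A (s, i, j) = A (s, j, i)}
  add_mem' := fun hA hB s i j => by simp [hA s i j, hB s i j]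
  zero_mem' := fun _ _ _ => rfl
  smul_mem' := fun c A hA s i j => by simp [hA s i j]

/-- The component `A_s` of a tuple of symmetric matrices. -/
def comp {m q : ℕ} (A : SymTuple m q) (s : Fin q) : Matrix (Fin (m + 1)) (Fin (m + 1)) ℝ :=
  Matrix.of fun i j => A.1 (s, i, j)

/-- The embedding `j_k ([x_1], …, [x_q]) = (x_1 x_1ᵀ, …, x_q x_qᵀ)`, the `x_s` being unit vectors. -/
def embed {m q : ℕ} (p : Axes m q) : SymTuple m q :=
  ⟨WithLp.toLp 2 fun k => unitRep (p k.1) k.2.1 * unitRep (p k.1) k.2.2,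
    fun _ _ _ => mul_comm _ _⟩

/-- `A` is nonfocal for `j_k`: exactly one point of `j_k ((ℝP^m)^q)` is nearest to `A`. -/
def Nonfocal {m q : ℕ} (A : SymTuple m q) : Prop :=
  ∃! p : Axes m q, ∀ p' : Axes m q, dist A (embed p) ≤ dist A (embed p')

/-- `j_k⁻¹ (P (A))`: the point of `(ℝP^m)^q` whose image is nearest to the nonfocal `A`. -/
def nearest {m q : ℕ} (A : SymTuple m q) (h : Nonfocal A) : Axes m q := h.choose

open Classical in
/-- The ortho-projection `P` on `j_k ((ℝP^m)^q)`, defined on nonfocal tuples (and set to `0` at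
focal ones). -/
def proj {m q : ℕ} (A : SymTuple m q) : SymTuple m q :=
  if h : Nonfocal A then embed (nearest A h) else 0

/-- `d` lists the eigenvalues of each `A_s` in increasing order, and `g s` is an orthonormal family
of corresponding eigenvectors. (The last index `Fin.last m` belongs to the largest eigenvalue.) -/
structure IsEigenFrame {m q : ℕ} (A : SymTuple m q) (d : Fin q → Fin (m + 1) → ℝ)
    (g : Fin q → Fin (m + 1) → Vec m) : Prop where
  monotone : ∀ s, Monotone (d s)
  orthonormal : ∀ s, Orthonormal ℝ (g s)
  eigen : ∀ s a, comp A s *ᵥ (g s a).ofLp = d s a • (g s a).ofLp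

/-- For an eigenframe `γ`, the tangent vector `e_(s,a) = d j_k (0, …, γ_s(a), …, 0)` at the point
`j_k ([γ_1(m+1)], …, [γ_q(m+1)])`: its `s`-th component is
`γ_s(a) γ_s(m+1)ᵀ + γ_s(m+1) γ_s(a)ᵀ`, the others vanish. -/
def tangentVec {m q : ℕ} (γ : Fin q → Fin (m + 1) → Vec m) (sa : Fin q × Fin m) : SymTuple m q :=
  ⟨WithLp.toLp 2 fun k =>
      if k.1 = sa.1 then
        γ sa.1 sa.2.castSucc k.2.1 * γ sa.1 (Fin.last m) k.2.2
          + γ sa.1 (Fin.last m) k.2.1 * γ sa.1 sa.2.castSucc k.2.2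
      else 0,
    fun s i j => by
      by_cases h : s = sa.1
      · simp [h]; ring
      · simp [h]⟩

/-- The coordinate of `A` along `e_(s,a)`. The `e_(s,a)` are orthonormal for the scalar product
`(A, B) ↦ ½ ∑ₛ tr (Aₛ Bₛ)`. -/
def tangentCoord {m q : ℕ} (γ : Fin q → Fin (m + 1) → Vec m) (sa : Fin q × Fin m)
    (A : SymTuple m q) : ℝ :=
  (1 / 2) * ⟪tangentVec γ sa, A⟫

variable {Ω : Type*} [MeasurableSpace Ω]

/-- The mean `μ = E (j_k (Y))`. -/
def meanEmbed {m q : ℕ} (P : Measure Ω) (Y : Ω → Axes m q) : SymTuple m q :=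
  ∫ ω, embed (Y ω) ∂P

/-- The extrinsic covariance matrix `Σ_E = B Σ Bᵀ` of `Y` with respect to the basis given by `γ`,
where `Σ` is the covariance of `j_k (Y)` and `B` is the matrix of `d_μ P` followed by taking the
coordinates along the `e_(s,a)`. -/
def extrinsicCov {m q : ℕ} (P : Measure Ω) (Y : Ω → Axes m q)
    (γ : Fin q → Fin (m + 1) → Vec m) : Matrix (Fin q × Fin m) (Fin q × Fin m) ℝ :=
  Matrix.of fun sa tb =>
    cov[fun ω => tangentCoord γ sa (fderiv ℝ proj (meanEmbed P Y) (embed (Y ω))),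
      fun ω => tangentCoord γ tb (fderiv ℝ proj (meanEmbed P Y) (embed (Y ω))); P]

/-- The sample mean `(J_1, …, J_q)` of `j_k (y_0), …, j_k (y_(n-1))`. -/
def sampleMean {m q : ℕ} (n : ℕ) (y : ℕ → Axes m q) : SymTuple m q :=
  (n : ℝ)⁻¹ • ∑ r ∈ Finset.range n, embed (y r)

/-- The extrinsic sample covariance matrix `G_n`, from unit representatives `x r s` of the data and
an eigenframe `(d, g)` of the sample mean. -/
def sampleCov {m q : ℕ} (n : ℕ) (x : ℕ → Fin q → Vec m) (d : Fin q → Fin (m + 1) → ℝ)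
    (g : Fin q → Fin (m + 1) → Vec m) : Matrix (Fin q × Fin m) (Fin q × Fin m) ℝ :=
  Matrix.of fun sa tb =>
    (n : ℝ)⁻¹ * (d sa.1 (Fin.last m) - d sa.1 sa.2.castSucc)⁻¹
      * (d tb.1 (Fin.last m) - d tb.1 tb.2.castSucc)⁻¹
      * ∑ r ∈ Finset.range n,
          ⟪g sa.1 sa.2.castSucc, x r sa.1⟫ * ⟪g tb.1 tb.2.castSucc, x r tb.1⟫
            * ⟪g sa.1 (Fin.last m), x r sa.1⟫ * ⟪g tb.1 (Fin.last m), x r tb.1⟫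

/-- The row vector `(γ_1ᵀ D_1, …, γ_qᵀ D_q)`, where `D_s = (g_s(1), …, g_s(m))`. -/
def deviation {m q : ℕ} (g : Fin q → Fin (m + 1) → Vec m) (γ : Fin q → Vec m) :
    Fin q × Fin m → ℝ :=
  fun sa => ⟪γ sa.1, g sa.1 sa.2.castSucc⟫

/-- The Hotelling type statistic
`T = n (γ_1ᵀ D_1, …, γ_qᵀ D_q) G_n⁻¹ (γ_1ᵀ D_1, …, γ_qᵀ D_q)ᵀ`. -/
def hotelling {m q : ℕ} (n : ℕ) (x : ℕ → Fin q → Vec m) (d : Fin q → Fin (m + 1) → ℝ)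
    (g : Fin q → Fin (m + 1) → Vec m) (γ : Fin q → Vec m) : ℝ :=
  n * (deviation g γ ⬝ᵥ ((sampleCov n x d g)⁻¹ *ᵥ deviation g γ))

/-- The `χ²` distribution with `N` degrees of freedom: the law of the sum of the squares of `N`
independent standard normal variables. -/
def chiSquared (N : ℕ) : Measure ℝ :=
  (Measure.pi fun _ : Fin N => gaussianReal 0 1).map fun z => ∑ i, z i ^ 2

/-- The upper tail `Pr (T > t)` for a `χ²_N` distributed `T`. -/
def chiSquaredTail (N : ℕ) (t : ℝ) : ℝ := (chiSquared N).real (Set.Ioi t)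

end ProjShape

end

open ProjShape

/-! Under `H₀` let `u` have the blocks `(J_s - μ_s) γ_s`, where `γ_s` is the leading eigenvector of
`μ_s`, with eigenvalue `λ_s`. Then `g_s(a)ᵀ (J_s - μ_s) γ_s = (d_s(a) - λ_s) g_s(a)ᵀ γ_s` exactly,
so no Taylor expansion is needed: once no `λ_s - d_s(a)` vanishes, `T = n uᵀ Q_n u` with `Q_n = W
G_n⁻¹ Wᵀ`, the columns of `W` being `(λ_s - d_s(a))⁻¹ g_s(a)` (`deviation_eq`, `hotelling_eq`). By
the law of large numbers `Q_n` tends to its population version `Q`, and `√n u` is bounded in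
probability, so `Q` may replace `Q_n`. The form with `Q` is the squared norm of a normalized sum of
whitened i.i.d. vectors, hence asymptotically `χ²` (`tendsto_tail_limit_form`).

The difficulty is that nonleading eigenvectors are neither unique nor continuous where eigenvalues
coincide. Two facts resolve it. With the leading vectors fixed, `Q` is the same for all eigenframes
of the population mean (`weightMat_eq`). And eigenframes form a closed, locally bounded set, so a
compactness argument makes estimates near the population moments hold for all eigenframes at once
(`eventually_forall_isEigenFrame`). The statistic may be nonmeasurable; Slutsky's lemma is therefore
proved with monotonicity and subadditivity of outer measure only. Pólya's theorem and the continuity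
of the `χ²` tail then give uniformity and the level of the p-value.

Under `H₁` the deviation vector is nonzero in every eigenframe of the population mean, and the same
compactness gives `T > n c` with `c > 0` outside events of vanishing probability.

The matrix `Σ_E` is identified by differentiating the commutation relation `A P(A) = P(A) A`, which
avoids perturbation theory of eigenvectors (`tangentCoord_fderiv_proj`). -/

namespace ProjShape

/-! ### Multivariate central limit theorem. -/

section CentralLimit

variable {Ω : Type*} [MeasurableSpace Ω] {P : Measure Ω} [IsProbabilityMeasure P]
  {E : Type*} [NormedAddCommGroup E] [InnerProductSpace ℝ E] [FiniteDimensional ℝ E]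
  [MeasurableSpace E] [BorelSpace E]

/-- The central limit theorem for centered vectors with identity covariance. -/
theorem tendsto_map_normalizedSum {ζ : ℕ → Ω → E} (hm : ∀ n, Measurable (ζ n))
    (hindep : iIndepFun ζ P) (hident : ∀ n, IdentDistrib (ζ n) (ζ 0) P P)
    (h0 : ∀ t : E, ∫ ω, ⟪ζ 0 ω, t⟫ ∂P = 0)
    (h1 : ∀ t : E, ∫ ω, ⟪ζ 0 ω, t⟫ ^ 2 ∂P = ‖t‖ ^ 2)
    (hS : ∀ n : ℕ, IsProbabilityMeasure
      (P.map fun ω => (√(n : ℝ))⁻¹ • ∑ k ∈ Finset.range n, ζ k ω)) :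
    Tendsto (β := ProbabilityMeasure E)
      (fun n : ℕ => ⟨P.map fun ω => (√(n : ℝ))⁻¹ • ∑ k ∈ Finset.range n, ζ k ω, hS n⟩) atTop
      (nhds (X := ProbabilityMeasure E) ⟨stdGaussian E, inferInstance⟩) := by
  refine ProbabilityMeasure.tendsto_iff_tendsto_charFun.2 fun t => ?_
  have hSm : ∀ n : ℕ, Measurable fun ω => (√(n : ℝ))⁻¹ • ∑ k ∈ Finset.range n, ζ k ω :=
    fun n => (Finset.measurable_fun_sum _ fun k _ => hm k).const_smul _
  rcases eq_or_ne t 0 with rfl | ht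
  · simp
  have ht' : ‖t‖ ≠ 0 := norm_ne_zero_iff.2 ht
  -- Cramér–Wold: the projection on the unit vector `e` has variance one, and `‖t‖` becomes the
  -- argument of a scalar characteristic function.
  set e : E := ‖t‖⁻¹ • t with he
  have hte : t = ‖t‖ • e := by rw [he, smul_smul, mul_inv_cancel₀ ht', one_smul]
  have hene : ‖e‖ = 1 := by rw [he, norm_smul, norm_inv, norm_norm, inv_mul_cancel₀ ht']
  have hinner : Measurable fun x : E => ⟪x, e⟫ := by fun_prop
  have hidX : ∀ k, IdentDistrib (fun ω => ⟪ζ k ω, e⟫) (fun ω => ⟪ζ 0 ω, e⟫) P P :=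
    fun k => (hident k).comp hinner
  have hinX : iIndepFun (fun k ω => ⟪ζ k ω, e⟫) P :=
    hindep.comp (fun _ x => ⟪x, e⟫) fun _ => hinner
  have key : ∀ n : ℕ, charFun (P.map fun ω => (√(n : ℝ))⁻¹ • ∑ k ∈ Finset.range n, ζ k ω) t =
      (charFun (P.map fun ω => ⟪ζ 0 ω, e⟫) ((√(n : ℝ))⁻¹ * ‖t‖)) ^ n := by
    intro n
    rw [← charFun_inv_sqrt_mul_sum (X := fun k ω => ⟪ζ k ω, e⟫) hinX hidX]
    rw [charFun_apply, charFun_apply, integral_map (hSm n).aemeasurable (by fun_prop),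
      integral_map (by fun_prop) (by fun_prop)]
    refine integral_congr_ae (.of_forall fun ω => ?_)
    simp only
    conv_lhs => rw [hte]
    rw [inner_smul_right, inner_smul_left, sum_inner]
    simp [mul_comm]
  have lim := tendsto_charFun_inv_sqrt_mul_pow (P := P) (X := fun ω => ⟪ζ 0 ω, e⟫)
    (hinner.comp (hm 0)).aemeasurable (h0 e) (by simpa [hene] using h1 e) ‖t‖
  simp only [ProbabilityMeasure.coe_mk, charFun_stdGaussian, key]
  exact lim

omit [IsProbabilityMeasure P] in
theorem map_norm_sq_stdGaussian :
    (stdGaussian E).map (fun x => ‖x‖ ^ 2) = chiSquared (Module.finrank ℝ E) := by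
  rw [stdGaussian, chiSquared, Measure.map_map (by fun_prop)
    (Finset.measurable_fun_sum _ fun i _ => by fun_prop)]
  congr 1
  ext x
  simp only [Function.comp]
  rw [← real_inner_self_eq_norm_sq, (stdOrthonormalBasis ℝ E).orthonormal.inner_sum]
  simp [sq]

end CentralLimit

/-! ### The `χ²` distribution and its tail. -/

section ChiSquared

instance isProbabilityMeasure_chiSquared (N : ℕ) : IsProbabilityMeasure (chiSquared N) :=
  Measure.isProbabilityMeasure_map (Measurable.aemeasurable (by fun_prop))

/-- By Fubini: once the other coordinates are fixed, at most two values of the first one are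
possible, and the Gaussian law has no atoms. -/
theorem chiSquared_singleton {N : ℕ} (hN : N ≠ 0) (t : ℝ) : chiSquared N {t} = 0 := by
  obtain ⟨k, rfl⟩ := Nat.exists_eq_succ_of_ne_zero hN
  have hmeas : Measurable fun z : Fin (k + 1) → ℝ => ∑ i, z i ^ 2 := by fun_prop
  rw [chiSquared, Measure.map_apply hmeas (measurableSet_singleton t)]
  have hmp := (measurePreserving_piFinSuccAbove (fun _ : Fin (k + 1) => gaussianReal 0 1) 0).symm
  rw [← hmp.measure_preimage (hmeas (measurableSet_singleton t)).nullMeasurableSet,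
    Measure.prod_apply_symm (hmp.measurable (hmeas (measurableSet_singleton t)))]
  refine (lintegral_congr fun y => ?_).trans lintegral_zero
  have := nullSingletonClass_gaussianReal (μ := 0) (one_ne_zero (α := NNReal))
  refine Set.Finite.measure_zero (Set.Finite.subset
    (s := {√(t - ∑ i, y i ^ 2), -√(t - ∑ i, y i ^ 2)}) (by simp) fun a ha => ?_) _
  have h : a ^ 2 + ∑ i, y i ^ 2 = t := by
    have := ha
    simp only [Set.mem_preimage, Set.mem_singleton_iff, Fin.sum_univ_succ] at this
    simpa [MeasurableEquiv.piFinSuccAbove, Fin.insertNthEquiv] using this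
  have h2 : t - ∑ i, y i ^ 2 = a ^ 2 := by linarith
  rw [h2, Real.sqrt_sq_eq_abs]
  rcases abs_choice a with h | h <;> simp [h]

theorem chiSquaredTail_antitone (N : ℕ) : Antitone (chiSquaredTail N) := fun _ _ h =>
  measureReal_mono (Set.Ioi_subset_Ioi h)

theorem chiSquaredTail_eq (N : ℕ) (t : ℝ) : chiSquaredTail N t = 1 - cdf (chiSquared N) t := by
  rw [chiSquaredTail, cdf_eq_real, ← Set.compl_Iic, measureReal_compl measurableSet_Iic]
  simp

theorem chiSquaredTail_continuous {N : ℕ} (hN : N ≠ 0) : Continuous (chiSquaredTail N) := by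
  have hc : Continuous (cdf (chiSquared N)) := by
    -- The jump of the distribution function at `t` is the mass of `{t}`, which is zero.
    refine continuous_iff_continuousAt.2 fun t => ?_
    have h := (cdf (chiSquared N)).measure_singleton t
    rw [measure_cdf, chiSquared_singleton hN] at h
    have h' : Function.leftLim (cdf (chiSquared N)) t = cdf (chiSquared N) t :=
      le_antisymm ((monotone_cdf _).leftLim_le le_rfl) (by
        have := ENNReal.ofReal_eq_zero.1 h.symm; linarith)
    exact continuousAt_iff_continuous_left'_right'.2
      ⟨(monotone_cdf _).continuousWithinAt_Iio_iff_leftLim_eq.2 h',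
      ((cdf (chiSquared N)).right_continuous t).mono Set.Ioi_subset_Ici_self⟩
  rw [funext (chiSquaredTail_eq N)]
  exact continuous_const.sub hc

theorem chiSquaredTail_tendsto_atTop (N : ℕ) : Tendsto (chiSquaredTail N) atTop (𝓝 0) := by
  simpa only [funext (chiSquaredTail_eq N), sub_self] using
    (tendsto_cdf_atTop (chiSquared N)).const_sub 1

theorem chiSquaredTail_tendsto_atBot (N : ℕ) : Tendsto (chiSquaredTail N) atBot (𝓝 1) := by
  simpa only [funext (chiSquaredTail_eq N), sub_zero] using
    (tendsto_cdf_atBot (chiSquared N)).const_sub 1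

end ChiSquared

/-! ### Convergence of tails, Slutsky's lemma and p-values. -/

section Tails

/-- A continuous function with limits `1` and `0` at `∓∞` attains all values in `(0, 1)`. -/
theorem exists_eq_of_tail {F : ℝ → ℝ} (hF : Continuous F) (hbot : Tendsto F atBot (𝓝 1))
    (htop : Tendsto F atTop (𝓝 0)) {y : ℝ} (h0 : 0 < y) (h1 : y < 1) : ∃ c, F c = y := by
  obtain ⟨a, ha⟩ := (hbot.eventually (lt_mem_nhds h1)).exists
  obtain ⟨b, hb⟩ := (htop.eventually (gt_mem_nhds h0)).exists
  exact mem_range_of_exists_le_of_exists_ge hF ⟨b, hb.le⟩ ⟨a, ha.le⟩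

/-- **Pólya's theorem**: pointwise convergence of tail functions to a continuous one is uniform. -/
theorem tendstoUniformly_of_tail {G : ℕ → ℝ → ℝ} {F : ℝ → ℝ} (hG : ∀ n, Antitone (G n))
    (hG0 : ∀ n t, 0 ≤ G n t) (hG1 : ∀ n t, G n t ≤ 1) (hF : Continuous F) (hFa : Antitone F)
    (hbot : Tendsto F atBot (𝓝 1)) (htop : Tendsto F atTop (𝓝 0))
    (h : ∀ t, Tendsto (fun n => G n t) atTop (𝓝 (F t))) : TendstoUniformly G F atTop := by
  rw [Metric.tendstoUniformly_iff]
  intro ε hε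
  obtain ⟨N, hN⟩ := exists_nat_one_div_lt (show (0 : ℝ) < ε / 4 by linarith)
  set M : ℝ := (N : ℝ) + 1 with hM
  have hMpos : 0 < M := by positivity
  -- Grid points at the levels `k / M`, with mesh below `ε / 4`; the value outside `0 < k < M` is a
  -- dummy.
  have hc : ∀ k : ℕ, ∃ c, 0 < k → (k : ℝ) < M → F c = k / M := by
    intro k
    by_cases hk : 0 < k ∧ (k : ℝ) < M
    · obtain ⟨c, hc⟩ := exists_eq_of_tail hF hbot htop (y := k / M)
        (div_pos (Nat.cast_pos.2 hk.1) hMpos) ((div_lt_one hMpos).2 hk.2)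
      exact ⟨c, fun _ _ => hc⟩
    · exact ⟨0, fun h1 h2 => absurd ⟨h1, h2⟩ hk⟩
  choose c hc using hc
  have hev : ∀ᶠ n in atTop, ∀ k ∈ Finset.range (N + 1), dist (G n (c k)) (F (c k)) < ε / 4 :=
    (Finset.eventually_all _).2 fun k _ => Metric.tendsto_nhds.1 (h (c k)) _ (by linarith)
  filter_upwards [hev] with n hn t
  have hFt0 : 0 ≤ F t := hFa.le_of_tendsto htop t
  have hFt1 : F t ≤ 1 := hFa.ge_of_tendsto hbot t
  set k := ⌊F t * M⌋₊ with hk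
  have hk1 : (k : ℝ) ≤ F t * M := Nat.floor_le (by positivity)
  have hk2 : F t * M < k + 1 := Nat.lt_floor_add_one _
  have hMi : 1 / M < ε / 4 := hN
  have hk1' : (k : ℝ) / M ≤ F t := (div_le_iff₀ hMpos).2 hk1
  have hk2' : F t < (k + 1) / M := (lt_div_iff₀ hMpos).2 hk2
  have hupper : G n t ≤ (k + 1) / M + ε / 4 := by
    by_cases hkM : (k : ℝ) + 1 < M
    · have hF' : F (c (k + 1)) = (k + 1) / M := by
        simpa using hc (k + 1) (Nat.succ_pos k) (by push_cast; exact hkM)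
      have hlt : c (k + 1) < t := by
        by_contra hcon
        have := hFa (not_lt.1 hcon)
        linarith
      have hmem : k + 1 ∈ Finset.range (N + 1) := by
        rw [Finset.mem_range]; rw [hM] at hkM; exact_mod_cast hkM
      have h1 := hn (k + 1) hmem
      rw [hF', Real.dist_eq, abs_lt] at h1
      have := hG n hlt.le
      linarith [h1.2]
    · have : 1 ≤ ((k : ℝ) + 1) / M := (one_le_div hMpos).2 (not_lt.1 hkM)
      linarith [hG1 n t]
  -- Level `k - 1` instead of `k`: `F t` may equal `k / M`, and only a strict inequality of levels
  -- orders the grid point and `t`.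
  have hlower : ((k : ℝ) - 1) / M - ε / 4 ≤ G n t := by
    rcases Nat.lt_or_ge 1 k with hk' | hk'
    · have hcast : ((k - 1 : ℕ) : ℝ) = (k : ℝ) - 1 := by
        rw [Nat.cast_sub hk'.le]; simp
      have hkM : (k : ℝ) ≤ M := hk1.trans (by nlinarith)
      have hF' : F (c (k - 1)) = ((k : ℝ) - 1) / M := by
        rw [hc (k - 1) (by omega) (by rw [hcast]; linarith), hcast]
      have hstep : ((k : ℝ) - 1) / M < F t := by
        refine lt_of_lt_of_le ?_ hk1'
        exact div_lt_div_of_pos_right (by linarith) hMpos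
      have hlt : t < c (k - 1) := by
        by_contra hcon
        have := hFa (not_lt.1 hcon)
        linarith
      have hmem : k - 1 ∈ Finset.range (N + 1) := by
        rw [Finset.mem_range]
        have : k ≤ N + 1 := by rw [hM] at hkM; exact_mod_cast hkM
        omega
      have h1 := hn (k - 1) hmem
      rw [hF', Real.dist_eq, abs_lt] at h1
      have := hG n hlt.le
      linarith [h1.1]
    · have : ((k : ℝ) - 1) / M ≤ 0 := by
        refine div_nonpos_of_nonpos_of_nonneg ?_ hMpos.le
        have : (k : ℝ) ≤ 1 := by exact_mod_cast hk'
        linarith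
      linarith [hG0 n t]
  rw [add_div] at hupper hk2'
  rw [sub_div] at hlower
  rw [Real.dist_eq, abs_lt]
  constructor <;> linarith

variable {Ω : Type*} [MeasurableSpace Ω] {P : Measure Ω} [IsProbabilityMeasure P]

/-- Slutsky's lemma for tails, for not necessarily measurable functions. -/
theorem tendsto_tail_of_tendsto_sub {T V : ℕ → Ω → ℝ} {F : ℝ → ℝ} (hF : Continuous F)
    (hV : ∀ t, Tendsto (fun n => P.real {ω | t < V n ω}) atTop (𝓝 (F t)))
    (hTV : ∀ ε > 0, Tendsto (fun n => P.real {ω | ε ≤ |T n ω - V n ω|}) atTop (𝓝 0)) (t : ℝ) :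
    Tendsto (fun n => P.real {ω | t < T n ω}) atTop (𝓝 (F t)) := by
  rw [tendsto_order]
  constructor
  · intro a ha
    obtain ⟨ε, hε, hFε⟩ : ∃ ε > 0, a < F (t + ε) := by
      have h : Tendsto (fun ε => F (t + ε)) (𝓝[>] 0) (𝓝 (F t)) := by
        have : ContinuousAt (fun ε => F (t + ε)) 0 := by fun_prop
        simpa using this.tendsto.mono_left nhdsWithin_le_nhds
      obtain ⟨ε, h1, h2⟩ := ((h.eventually (lt_mem_nhds ha)).and self_mem_nhdsWithin).exists
      exact ⟨ε, h2, h1⟩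
    have hlim := (hV (t + ε)).sub (hTV ε hε)
    rw [sub_zero] at hlim
    filter_upwards [hlim.eventually (lt_mem_nhds hFε)] with n hn
    -- The inclusion `{t + ε < V} ⊆ {t < T} ∪ {ε ≤ |T - V|}` needs only monotonicity and
    -- subadditivity, valid for nonmeasurable sets.
    refine hn.trans_le (sub_le_iff_le_add.2 ((measureReal_mono ?_).trans (measureReal_union_le _ _)))
    intro ω hω
    by_cases hc : ε ≤ |T n ω - V n ω|
    · exact Or.inr hc
    · refine Or.inl ?_
      have h1 := (abs_lt.1 (not_le.1 hc)).1
      simp only [Set.mem_ofPred_eq] at hω ⊢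
      linarith
  · intro a ha
    obtain ⟨ε, hε, hFε⟩ : ∃ ε > 0, F (t - ε) < a := by
      have h : Tendsto (fun ε => F (t - ε)) (𝓝[>] 0) (𝓝 (F t)) := by
        have : ContinuousAt (fun ε => F (t - ε)) 0 := by fun_prop
        simpa using this.tendsto.mono_left nhdsWithin_le_nhds
      obtain ⟨ε, h1, h2⟩ := ((h.eventually (gt_mem_nhds ha)).and self_mem_nhdsWithin).exists
      exact ⟨ε, h2, h1⟩
    have hlim := (hV (t - ε)).add (hTV ε hε)
    rw [add_zero] at hlim
    filter_upwards [hlim.eventually (gt_mem_nhds hFε)] with n hn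
    refine lt_of_le_of_lt ((measureReal_mono ?_).trans (measureReal_union_le _ _)) hn
    intro ω hω
    by_cases hc : ε ≤ |T n ω - V n ω|
    · exact Or.inr hc
    · refine Or.inl ?_
      have h1 := (abs_lt.1 (not_le.1 hc)).2
      simp only [Set.mem_ofPred_eq] at hω ⊢
      linarith

/-- The tail function of the limit distribution, evaluated at the statistic, is asymptotically
uniformly distributed. -/
theorem tendsto_pvalue {T : ℕ → Ω → ℝ} {F : ℝ → ℝ} (hF : Continuous F) (hFa : Antitone F)
    (hbot : Tendsto F atBot (𝓝 1)) (htop : Tendsto F atTop (𝓝 0))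
    (hT : ∀ t, Tendsto (fun n => P.real {ω | t < T n ω}) atTop (𝓝 (F t)))
    {α : ℝ} (hα : α ∈ Set.Icc (0 : ℝ) 1) :
    Tendsto (fun n => P.real {ω | F (T n ω) ≤ α}) atTop (𝓝 α) := by
  rcases eq_or_lt_of_le hα.2 with rfl | h1
  · have : ∀ n, {ω | F (T n ω) ≤ 1} = Set.univ := fun n =>
      Set.eq_univ_of_forall fun ω => hFa.ge_of_tendsto hbot _
    simp [this]
  rw [tendsto_order]
  constructor
  · intro a ha
    rcases eq_or_lt_of_le hα.1 with rfl | h0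
    · exact .of_forall fun n => ha.trans_le measureReal_nonneg
    obtain ⟨c, hc⟩ := exists_eq_of_tail hF hbot htop h0 h1
    have hlim := hT c
    rw [hc] at hlim
    filter_upwards [hlim.eventually (lt_mem_nhds ha)] with n hn
    refine hn.trans_le (measureReal_mono fun ω hω => ?_)
    exact (hFa (le_of_lt hω)).trans hc.le
  · intro a ha
    -- `F` need not be strictly decreasing, so a level `b` above `α` is used: `F T ≤ α < b = F c`
    -- forces `T > c`.
    obtain ⟨b, hb, hb'⟩ := exists_between (lt_min ha h1)
    obtain ⟨c, hc⟩ := exists_eq_of_tail hF hbot htop (hα.1.trans_lt hb)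
      (hb'.trans_le (min_le_right _ _))
    have hlim := hT c
    rw [hc] at hlim
    filter_upwards [hlim.eventually (gt_mem_nhds (hb'.trans_le (min_le_left _ _)))] with n hn
    refine lt_of_le_of_lt (measureReal_mono fun ω hω => ?_) hn
    by_contra hcon
    have h2 := hFa (not_lt.1 hcon)
    have h3 : F (T n ω) ≤ α := hω
    linarith

end Tails

/-! ### `χ²` limit of squared norms of normalized sums. -/

section ChiSquaredLimit

variable {Ω : Type*} [MeasurableSpace Ω] {P : Measure Ω} [IsProbabilityMeasure P]
  {E : Type*} [NormedAddCommGroup E] [InnerProductSpace ℝ E] [FiniteDimensional ℝ E]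
  [MeasurableSpace E] [BorelSpace E]

/-- Portmanteau theorem: the boundary of `{t < ‖x‖ ^ 2}` lies in a level set of the squared norm,
which is Gaussian-null because `χ²` has no atoms. -/
theorem tendsto_tail_normalizedSum {ζ : ℕ → Ω → E} (hm : ∀ n, Measurable (ζ n))
    (hindep : iIndepFun ζ P) (hident : ∀ n, IdentDistrib (ζ n) (ζ 0) P P)
    (h0 : ∀ t : E, ∫ ω, ⟪ζ 0 ω, t⟫ ∂P = 0)
    (h1 : ∀ t : E, ∫ ω, ⟪ζ 0 ω, t⟫ ^ 2 ∂P = ‖t‖ ^ 2)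
    (hE : Module.finrank ℝ E ≠ 0) (t : ℝ) :
    Tendsto (fun n : ℕ =>
      P.real {ω | t < ‖(√(n : ℝ))⁻¹ • ∑ k ∈ Finset.range n, ζ k ω‖ ^ 2}) atTop
      (𝓝 (chiSquaredTail (Module.finrank ℝ E) t)) := by
  have hSm : ∀ n : ℕ, Measurable fun ω => (√(n : ℝ))⁻¹ • ∑ k ∈ Finset.range n, ζ k ω :=
    fun n => (Finset.measurable_fun_sum _ fun k _ => hm k).const_smul _
  have hS : ∀ n : ℕ, IsProbabilityMeasure
      (P.map fun ω => (√(n : ℝ))⁻¹ • ∑ k ∈ Finset.range n, ζ k ω) :=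
    fun n => Measure.isProbabilityMeasure_map (hSm n).aemeasurable
  have hcont : Continuous fun x : E => ‖x‖ ^ 2 := by fun_prop
  have hopen : IsOpen {x : E | t < ‖x‖ ^ 2} := isOpen_lt continuous_const hcont
  have hnull : (stdGaussian E) (frontier {x : E | t < ‖x‖ ^ 2}) = 0 := by
    refine measure_mono_null (frontier_lt_subset_eq continuous_const hcont) ?_
    have := chiSquared_singleton hE t
    rw [← map_norm_sq_stdGaussian, Measure.map_apply hcont.measurable (by simp)] at this
    convert this using 2
    ext x
    simp [eq_comm]
  have hlim := ProbabilityMeasure.tendsto_measure_of_null_frontier_of_tendsto'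
    (tendsto_map_normalizedSum hm hindep hident h0 h1 hS) hnull
  have hlim' := (ENNReal.tendsto_toReal (measure_ne_top (stdGaussian E) _)).comp hlim
  have hval : ((stdGaussian E) {x : E | t < ‖x‖ ^ 2}).toReal =
      chiSquaredTail (Module.finrank ℝ E) t := by
    rw [chiSquaredTail, ← map_norm_sq_stdGaussian, measureReal_def,
      Measure.map_apply hcont.measurable measurableSet_Ioi]
    rfl
  rw [← hval]
  refine hlim'.congr fun n => ?_
  simp only [Function.comp, ProbabilityMeasure.coe_mk, measureReal_def]
  rw [Measure.map_apply (hSm n) hopen.measurableSet]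
  rfl

end ChiSquaredLimit

variable {m q : ℕ}

/-! ### Unit representatives of axes. -/

section UnitRepresentatives

theorem IsUnitRep.ne_zero {x : Vec m} {p : RP m} (h : IsUnitRep x p) : x ≠ 0 :=
  norm_ne_zero_iff.1 (by rw [h.1]; exact one_ne_zero)

theorem IsUnitRep.mk_eq {x : Vec m} {p : RP m} (h : IsUnitRep x p) :
    Projectivization.mk ℝ x h.ne_zero = p := by
  have h2 := h.2
  rw [Projectivization.submodule_eq, Submodule.mem_span_singleton] at h2
  obtain ⟨a, ha⟩ := h2
  refine Eq.trans ?_ p.mk_rep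
  rw [Projectivization.mk_eq_mk_iff']
  exact ⟨a, ha⟩

theorem isUnitRep_mk {x : Vec m} (hx : ‖x‖ = 1) (h0 : x ≠ 0) :
    IsUnitRep x (Projectivization.mk ℝ x h0) :=
  ⟨hx, by rw [Projectivization.submodule_mk]; exact Submodule.mem_span_singleton_self x⟩

theorem isUnitRep_unitRep (p : RP m) : IsUnitRep (unitRep p) p := by
  refine ⟨?_, ?_⟩
  · rw [unitRep, norm_smul, norm_inv, norm_norm, inv_mul_cancel₀ (norm_ne_zero_iff.2 p.rep_nonzero)]
  · rw [Projectivization.submodule_eq, unitRep]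
    exact Submodule.smul_mem _ _ (Submodule.mem_span_singleton_self _)

theorem IsUnitRep.eq_or_eq_neg {x y : Vec m} {p : RP m} (hx : IsUnitRep x p)
    (hy : IsUnitRep y p) : x = y ∨ x = -y := by
  obtain ⟨a, ha⟩ := (Projectivization.mk_eq_mk_iff' ℝ x y hx.ne_zero hy.ne_zero).1
    (hx.mk_eq.trans hy.mk_eq.symm)
  have hn : |a| = 1 := by
    have := congrArg norm ha
    rwa [norm_smul, hx.1, hy.1, mul_one] at this
  rcases eq_or_eq_neg_of_abs_eq hn with rfl | rfl
  · left; rw [← ha, one_smul]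
  · right; rw [← ha, neg_one_smul]

theorem IsUnitRep.mul_eq_mul {x y : Vec m} {p : RP m} (hx : IsUnitRep x p)
    (hy : IsUnitRep y p) (i j : Fin (m + 1)) : x i * x j = y i * y j := by
  rcases hx.eq_or_eq_neg hy with rfl | rfl <;> simp

theorem IsUnitRep.eq_axis {x : Vec m} {p p' : RP m} (hx : IsUnitRep x p) (hx' : IsUnitRep x p') :
    p = p' := hx.mk_eq.symm.trans hx'.mk_eq

end UnitRepresentatives

/-! ### Matrix tuples as operators, and distances to the embedded space. -/

section Operators

/-- The operator on `ℝ^(m+1)` given by the component `A_s`. -/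
noncomputable def op (A : SymTuple m q) (s : Fin q) : Vec m →ₗ[ℝ] Vec m := Matrix.toLpLin 2 2 (comp A s)

theorem inner_op_eq_sum (A : SymTuple m q) (s : Fin q) (x y : Vec m) :
    ⟪x, op A s y⟫ = ∑ i, ∑ j, x i * A.1 (s, i, j) * y j := by
  rw [EuclideanSpace.inner_eq_star_dotProduct, op, Matrix.toLpLin_apply]
  simp only [dotProduct, Matrix.mulVec, comp, Matrix.of_apply, Finset.sum_mul, Pi.star_apply,
    star_trivial]
  refine Finset.sum_congr rfl fun i _ => Finset.sum_congr rfl fun j _ => by ring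

theorem inner_op_comm (A : SymTuple m q) (s : Fin q) (x y : Vec m) :
    ⟪x, op A s y⟫ = ⟪op A s x, y⟫ := by
  rw [real_inner_comm _ (op A s x), inner_op_eq_sum, inner_op_eq_sum, Finset.sum_comm]
  refine Finset.sum_congr rfl fun i _ => Finset.sum_congr rfl fun j _ => ?_
  rw [A.2 s i j]; ring

theorem inner_op_sub (A B : SymTuple m q) (s : Fin q) (x y : Vec m) :
    ⟪x, op (A - B) s y⟫ = ⟪x, op A s y⟫ - ⟪x, op B s y⟫ := by
  simp only [inner_op_eq_sum, ← Finset.sum_sub_distrib]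
  refine Finset.sum_congr rfl fun i _ => Finset.sum_congr rfl fun j _ => ?_
  simp only [Submodule.coe_sub, PiLp.sub_apply]; ring

theorem embed_apply (p : Axes m q) {x : Fin q → Vec m} (hx : ∀ s, IsUnitRep (x s) (p s))
    (s : Fin q) (i j : Fin (m + 1)) : (embed p).1 (s, i, j) = x s i * x s j :=
  (isUnitRep_unitRep (p s)).mul_eq_mul (hx s) i j

theorem inner_op_embed (p : Axes m q) {x : Fin q → Vec m} (hx : ∀ s, IsUnitRep (x s) (p s))
    (s : Fin q) (u v : Vec m) : ⟪u, op (embed p) s v⟫ = ⟪u, x s⟫ * ⟪v, x s⟫ := by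
  rw [inner_op_eq_sum, EuclideanSpace.inner_eq_star_dotProduct,
    EuclideanSpace.inner_eq_star_dotProduct]
  simp only [dotProduct, Pi.star_apply, star_trivial, Finset.sum_mul_sum, embed_apply p hx]
  refine Finset.sum_congr rfl fun i _ => Finset.sum_congr rfl fun j _ => by ring

theorem inner_eq_sum (A B : SymTuple m q) :
    ⟪A, B⟫ = ∑ s, ∑ i, ∑ j, A.1 (s, i, j) * B.1 (s, i, j) := by
  rw [Submodule.coe_inner, EuclideanSpace.inner_eq_star_dotProduct]
  simp only [dotProduct, Pi.star_apply, star_trivial, Fintype.sum_prod_type]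
  refine Finset.sum_congr rfl fun s _ => Finset.sum_congr rfl fun i _ =>
    Finset.sum_congr rfl fun j _ => mul_comm _ _

theorem inner_embed (A : SymTuple m q) (p : Axes m q) {x : Fin q → Vec m}
    (hx : ∀ s, IsUnitRep (x s) (p s)) : ⟪A, embed p⟫ = ∑ s, ⟪x s, op A s (x s)⟫ := by
  simp only [inner_eq_sum, inner_op_eq_sum, embed_apply p hx]
  refine Finset.sum_congr rfl fun s _ => Finset.sum_congr rfl fun i _ =>
    Finset.sum_congr rfl fun j _ => by ring

theorem norm_embed_sq (p : Axes m q) : ‖embed p‖ ^ 2 = q := by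
  have hx := fun s => isUnitRep_unitRep (p s)
  rw [← real_inner_self_eq_norm_sq, inner_embed _ p hx]
  simp only [inner_op_embed p hx, real_inner_self_eq_norm_sq, (hx _).1]
  simp

/-- All embedded points have the same norm, so minimizing the distance amounts to maximizing the
inner product. -/
theorem dist_embed_le_iff (A : SymTuple m q) (p p' : Axes m q) :
    dist A (embed p) ≤ dist A (embed p') ↔ ⟪A, embed p'⟫ ≤ ⟪A, embed p⟫ := by
  rw [dist_eq_norm, dist_eq_norm, ← sq_le_sq₀ (norm_nonneg _) (norm_nonneg _), norm_sub_sq_real,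
    norm_sub_sq_real, norm_embed_sq, norm_embed_sq]
  constructor <;> intro h <;> linarith

/-- An orthonormal family of `m + 1` vectors, as a basis. -/
noncomputable def frameBasis {g : Fin (m + 1) → Vec m} (h : Orthonormal ℝ g) :
    OrthonormalBasis (Fin (m + 1)) ℝ (Vec m) :=
  OrthonormalBasis.mk h (h.linearIndependent.span_eq_top_of_card_eq_finrank' (by simp)).ge

@[simp]
theorem frameBasis_apply {g : Fin (m + 1) → Vec m} (h : Orthonormal ℝ g) (a : Fin (m + 1)) :
    frameBasis h a = g a := by simp [frameBasis]

theorem sum_inner_mul_inner_frame {g : Fin (m + 1) → Vec m} (h : Orthonormal ℝ g) (x y : Vec m) :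
    ∑ a, ⟪x, g a⟫ * ⟪g a, y⟫ = ⟪x, y⟫ := by
  simpa using (frameBasis h).sum_inner_mul_inner x y

end Operators

/-! ### Eigenframes and the nearest point. -/

section EigenFrames

variable {A : SymTuple m q} {d : Fin q → Fin (m + 1) → ℝ} {g : Fin q → Fin (m + 1) → Vec m}

theorem IsEigenFrame.op_apply (h : IsEigenFrame A d g) (s : Fin q) (a : Fin (m + 1)) :
    op A s (g s a) = d s a • g s a := by
  rw [op, Matrix.toLpLin_apply, h.eigen s a]; rfl

theorem IsEigenFrame.norm_eq_one (h : IsEigenFrame A d g) (s : Fin q) (a : Fin (m + 1)) :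
    ‖g s a‖ = 1 := (h.orthonormal s).1 a

theorem IsEigenFrame.ne_zero (h : IsEigenFrame A d g) (s : Fin q) (a : Fin (m + 1)) :
    g s a ≠ 0 := (h.orthonormal s).ne_zero a

theorem IsEigenFrame.inner_eq (h : IsEigenFrame A d g) (s : Fin q) (a b : Fin (m + 1)) :
    ⟪g s a, g s b⟫ = if a = b then 1 else 0 := orthonormal_iff_ite.1 (h.orthonormal s) a b

theorem IsEigenFrame.inner_op_right (h : IsEigenFrame A d g) (s : Fin q) (a : Fin (m + 1))
    (x : Vec m) : ⟪x, op A s (g s a)⟫ = d s a * ⟪x, g s a⟫ := by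
  rw [h.op_apply, inner_smul_right]

theorem IsEigenFrame.inner_op_left (h : IsEigenFrame A d g) (s : Fin q) (a : Fin (m + 1))
    (x : Vec m) : ⟪g s a, op A s x⟫ = d s a * ⟪g s a, x⟫ := by
  rw [inner_op_comm, h.op_apply, inner_smul_left]; rfl

theorem IsEigenFrame.inner_op_self (h : IsEigenFrame A d g) (s : Fin q) (x : Vec m) :
    ⟪x, op A s x⟫ = ∑ a, d s a * ⟪x, g s a⟫ ^ 2 := by
  rw [← sum_inner_mul_inner_frame (h.orthonormal s)]
  refine Finset.sum_congr rfl fun a _ => ?_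
  rw [h.inner_op_left, real_inner_comm]; ring

theorem IsEigenFrame.sum_inner_sq (h : IsEigenFrame A d g) (s : Fin q) (x : Vec m) :
    ∑ a, ⟪x, g s a⟫ ^ 2 = ‖x‖ ^ 2 := by
  rw [← real_inner_self_eq_norm_sq, ← sum_inner_mul_inner_frame (h.orthonormal s)]
  refine Finset.sum_congr rfl fun a _ => ?_
  rw [real_inner_comm (g s a) x]; ring

theorem IsEigenFrame.inner_op_self_le (h : IsEigenFrame A d g) (s : Fin q) (x : Vec m)
    (hx : ‖x‖ = 1) : ⟪x, op A s x⟫ ≤ d s (Fin.last m) := by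
  rw [h.inner_op_self]
  calc ∑ a, d s a * ⟪x, g s a⟫ ^ 2 ≤ ∑ a, d s (Fin.last m) * ⟪x, g s a⟫ ^ 2 :=
        Finset.sum_le_sum fun a _ =>
          mul_le_mul_of_nonneg_right (h.monotone s (Fin.le_last a)) (sq_nonneg _)
    _ = d s (Fin.last m) := by rw [← Finset.mul_sum, h.sum_inner_sq, hx]; ring

/-- The axes of the leading eigenvectors of a frame. -/
noncomputable def topAxes (h : IsEigenFrame A d g) : Axes m q :=
  fun s => Projectivization.mk ℝ (g s (Fin.last m)) (h.ne_zero s _)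

theorem isUnitRep_topAxes (h : IsEigenFrame A d g) (s : Fin q) :
    IsUnitRep (g s (Fin.last m)) (topAxes h s) := isUnitRep_mk (h.norm_eq_one s _) _

/-- The inner product is a sum of independent Rayleigh quotients, each maximal at a leading
eigenvector. -/
theorem inner_embed_le_topAxes (h : IsEigenFrame A d g) (p : Axes m q) :
    ⟪A, embed p⟫ ≤ ⟪A, embed (topAxes h)⟫ := by
  rw [inner_embed A p fun s => isUnitRep_unitRep (p s), inner_embed A _ (isUnitRep_topAxes h)]
  refine Finset.sum_le_sum fun s _ => ?_
  rw [h.inner_op_right, real_inner_self_eq_norm_sq, h.norm_eq_one, one_pow, mul_one]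
  exact h.inner_op_self_le s _ (isUnitRep_unitRep (p s)).1

theorem nearest_eq_of_isMax (hA : Nonfocal A) {p : Axes m q}
    (hp : ∀ p', ⟪A, embed p'⟫ ≤ ⟪A, embed p⟫) : nearest A hA = p :=
  (hA.choose_spec.2 p fun p' => (dist_embed_le_iff A p p').2 (hp p')).symm

theorem nearest_eq_topAxes (hA : Nonfocal A) (h : IsEigenFrame A d g) :
    nearest A hA = topAxes h := nearest_eq_of_isMax hA (inner_embed_le_topAxes h)

/-- At a nonfocal point the leading eigenvalues are simple. -/
theorem IsEigenFrame.lt_last (h : IsEigenFrame A d g) (hA : Nonfocal A) (s : Fin q) (a : Fin m) :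
    d s a.castSucc < d s (Fin.last m) := by
  refine lt_of_le_of_ne (h.monotone s (Fin.le_last _)) fun heq => ?_
  -- If the leading eigenvalue were multiple, exchanging the `s`-th axis for another eigenvector
  -- would give a second maximizer.
  set p : Axes m q := fun t =>
    if t = s then Projectivization.mk ℝ (g s a.castSucc) (h.ne_zero s _) else topAxes h t with hp
  have hx : ∀ t, IsUnitRep (if t = s then g s a.castSucc else g t (Fin.last m)) (p t) := by
    intro t
    by_cases hts : t = s
    · simpa [hp, hts] using isUnitRep_mk (h.norm_eq_one s _) _
    · simpa [hp, hts] using isUnitRep_topAxes h t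
  have hval : ⟪A, embed p⟫ = ⟪A, embed (topAxes h)⟫ := by
    rw [inner_embed A p hx, inner_embed A _ (isUnitRep_topAxes h)]
    refine Finset.sum_congr rfl fun t _ => ?_
    by_cases hts : t = s
    · subst hts
      simp only [if_true, h.inner_op_right, real_inner_self_eq_norm_sq, h.norm_eq_one, heq]
    · simp only [hts, if_false]
  have h1 := nearest_eq_of_isMax hA fun p' => (inner_embed_le_topAxes h p').trans hval.ge
  rw [nearest_eq_topAxes hA h] at h1
  have h2 := isUnitRep_topAxes h s
  have h3 := hx s
  rw [← h1] at h3
  simp only [if_true] at h3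
  have horth := h.inner_eq s a.castSucc (Fin.last m)
  rw [if_neg (Fin.castSucc_lt_last a).ne] at horth
  rcases h2.eq_or_eq_neg h3 with h4 | h4
  · rw [← h4, real_inner_self_eq_norm_sq, h.norm_eq_one] at horth; norm_num at horth
  · rw [h4, inner_neg_right, real_inner_self_eq_norm_sq, h.norm_eq_one] at horth
    norm_num at horth

theorem exists_isEigenFrame (A : SymTuple m q) : ∃ d g, IsEigenFrame A d g := by
  have hsym : ∀ s, (op A s).IsSymmetric := fun s x y => (inner_op_comm A s x y).symm
  have hn : Module.finrank ℝ (Vec m) = m + 1 := by simp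
  -- `eigenvalues` is decreasing; `rev` puts the list in increasing order.
  refine ⟨fun s a => (hsym s).eigenvalues hn a.rev, fun s a => (hsym s).eigenvectorBasis hn a.rev,
    fun s a b hab => (hsym s).eigenvalues_antitone hn (Fin.rev_le_rev.2 hab),
    fun s => ((hsym s).eigenvectorBasis hn).orthonormal.comp _ Fin.rev_injective, fun s a => ?_⟩
  exact congrArg WithLp.ofLp ((hsym s).apply_eigenvectorBasis hn a.rev)

/-- Two frames of a tuple with simple leading eigenvalues have the same leading eigenvalues. -/
theorem IsEigenFrame.last_eq {d' : Fin q → Fin (m + 1) → ℝ} {g' : Fin q → Fin (m + 1) → Vec m}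
    (h : IsEigenFrame A d g) (h' : IsEigenFrame A d' g') (s : Fin q) :
    d' s (Fin.last m) = d s (Fin.last m) := by
  refine le_antisymm ?_ ?_
  · have := h.inner_op_self_le s _ (h'.norm_eq_one s (Fin.last m))
    rwa [h'.inner_op_right, real_inner_self_eq_norm_sq, h'.norm_eq_one, one_pow, mul_one] at this
  · have := h'.inner_op_self_le s _ (h.norm_eq_one s (Fin.last m))
    rwa [h.inner_op_right, real_inner_self_eq_norm_sq, h.norm_eq_one, one_pow, mul_one] at this

theorem IsEigenFrame.last_eq_or_eq_neg (hA : Nonfocal A) {d' : Fin q → Fin (m + 1) → ℝ}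
    {g' : Fin q → Fin (m + 1) → Vec m}
    (h : IsEigenFrame A d g) (h' : IsEigenFrame A d' g') (s : Fin q) :
    g' s (Fin.last m) = g s (Fin.last m) ∨ g' s (Fin.last m) = -g s (Fin.last m) := by
  refine (isUnitRep_topAxes h' s).eq_or_eq_neg (p := topAxes h' s) ?_
  rw [← nearest_eq_topAxes hA h', nearest_eq_topAxes hA h]
  exact isUnitRep_topAxes h s

end EigenFrames

/-! ### Derivative of the projection. -/

section Derivative

/-- `A` commutes with the projection on its leading eigenvectors. Thanks to the value `0` at focal
points this holds for every `A`, so it can be differentiated without knowing that nonfocal points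
form an open set. -/
theorem op_proj_comm (A : SymTuple m q) (s : Fin q) (x y : Vec m) :
    ⟪op A s x, op (proj A) s y⟫ = ⟪op (proj A) s x, op A s y⟫ := by
  by_cases hA : Nonfocal A
  · obtain ⟨d, g, h⟩ := exists_isEigenFrame A
    have hp : proj A = embed (topAxes h) := by rw [proj, dif_pos hA, nearest_eq_topAxes hA h]
    rw [hp, ← inner_op_comm (embed (topAxes h)) s x, inner_op_embed _ (isUnitRep_topAxes h),
      inner_op_embed _ (isUnitRep_topAxes h), ← inner_op_comm, ← inner_op_comm, h.inner_op_right,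
      h.inner_op_right]
    ring
  · have hp : proj A = 0 := by rw [proj, dif_neg hA]
    have h0 : ∀ z : Vec m, op (0 : SymTuple m q) s z = 0 := by
      intro z
      refine ext_inner_left ℝ fun v => ?_
      rw [inner_op_eq_sum]; simp
    rw [hp, h0, h0, inner_zero_left, inner_zero_right]

/-- The two terms of the tangent vector contribute equally by symmetry, which absorbs the factor `1
/ 2`. -/
theorem tangentCoord_eq (γ : Fin q → Fin (m + 1) → Vec m) (sa : Fin q × Fin m)
    (A : SymTuple m q) :
    tangentCoord γ sa A = ⟪γ sa.1 sa.2.castSucc, op A sa.1 (γ sa.1 (Fin.last m))⟫ := by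
  have h1 : ⟪tangentVec γ sa, A⟫ = ⟪γ sa.1 sa.2.castSucc, op A sa.1 (γ sa.1 (Fin.last m))⟫
      + ⟪γ sa.1 (Fin.last m), op A sa.1 (γ sa.1 sa.2.castSucc)⟫ := by
    rw [inner_eq_sum, inner_op_eq_sum, inner_op_eq_sum, Finset.sum_eq_single sa.1,
      ← Finset.sum_add_distrib]
    · refine Finset.sum_congr rfl fun i _ => ?_
      rw [← Finset.sum_add_distrib]
      refine Finset.sum_congr rfl fun j _ => ?_
      simp only [tangentVec, if_true]; ring
    · intro s _ hs
      refine Finset.sum_eq_zero fun i _ => Finset.sum_eq_zero fun j _ => ?_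
      simp [tangentVec, hs]
    · simp
  rw [tangentCoord, h1, inner_op_comm A _ (γ sa.1 (Fin.last m)),
    real_inner_comm _ (op A sa.1 (γ sa.1 (Fin.last m)))]
  ring

/-- The operator of `A_s` applied to `y`, as a linear map of `A`. -/
noncomputable def opAt (s : Fin q) (y : Vec m) : SymTuple m q →ₗ[ℝ] Vec m where
  toFun A := op A s y
  map_add' A B := by
    refine ext_inner_left ℝ fun v => ?_
    rw [inner_add_right]
    simp only [inner_op_eq_sum, ← Finset.sum_add_distrib]
    refine Finset.sum_congr rfl fun i _ => Finset.sum_congr rfl fun j _ => ?_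
    simp only [Submodule.coe_add, PiLp.add_apply]; ring
  map_smul' c A := by
    refine ext_inner_left ℝ fun v => ?_
    simp only [RingHom.id_apply, inner_smul_right, inner_op_eq_sum, Finset.mul_sum]
    refine Finset.sum_congr rfl fun i _ => Finset.sum_congr rfl fun j _ => ?_
    simp only [Submodule.coe_smul, PiLp.smul_apply, smul_eq_mul]; ring

theorem hasDerivAt_op {f : ℝ → SymTuple m q} {f' : SymTuple m q} {t : ℝ} (hf : HasDerivAt f f' t)
    (s : Fin q) (y : Vec m) : HasDerivAt (fun t => op (f t) s y) (op f' s y) t :=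
  (LinearMap.toContinuousLinearMap (opAt s y)).hasFDerivAt.comp_hasDerivAt t hf

/-- The derivative of the projection at a nonfocal point, in the tangent coordinates. -/
theorem tangentCoord_fderiv_proj {A : SymTuple m q} {d : Fin q → Fin (m + 1) → ℝ}
    {g : Fin q → Fin (m + 1) → Vec m} (h : IsEigenFrame A d g) (hA : Nonfocal A)
    (hdiff : DifferentiableAt ℝ proj A) (sa : Fin q × Fin m) (B : SymTuple m q) :
    tangentCoord g sa (fderiv ℝ proj A B) =
      (d sa.1 (Fin.last m) - d sa.1 sa.2.castSucc)⁻¹ *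
        ⟪g sa.1 sa.2.castSucc, op B sa.1 (g sa.1 (Fin.last m))⟫ := by
  obtain ⟨s, a⟩ := sa
  rw [tangentCoord_eq]
  simp only
  set L := fderiv ℝ proj A B with hL
  have hline : HasDerivAt (fun t : ℝ => A + t • B) B 0 := by
    simpa using ((hasDerivAt_id (0 : ℝ)).smul_const B).const_add A
  have hpr : HasDerivAt (fun t : ℝ => proj (A + t • B)) L 0 := by
    have h1 : HasFDerivAt proj (fderiv ℝ proj A) ((fun t : ℝ => A + t • B) 0) := by
      simpa using hdiff.hasFDerivAt
    exact h1.comp_hasDerivAt (0 : ℝ) hline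
  have hleft := (hasDerivAt_op hline s (g s a.castSucc)).inner ℝ
    (hasDerivAt_op hpr s (g s (Fin.last m)))
  have hright := (hasDerivAt_op hpr s (g s a.castSucc)).inner ℝ
    (hasDerivAt_op hline s (g s (Fin.last m)))
  -- Equating the two derivatives along `A + t B` gives `(d_s(m+1) - d_s(a)) ⟪g_s(a), L g_s(m+1)⟫ =
  -- ⟪g_s(a), B g_s(m+1)⟫`.
  have heq := hleft.unique (hright.congr_of_eventuallyEq
    (.of_forall fun t => op_proj_comm (A + t • B) s _ _))
  have hp : proj A = embed (topAxes h) := by rw [proj, dif_pos hA, nearest_eq_topAxes hA h]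
  have hne := h.lt_last hA s a
  simp only [zero_smul, add_zero, hp] at heq
  rw [real_inner_comm _ (op (embed _) s _), inner_op_embed _ (isUnitRep_topAxes h),
    inner_op_embed _ (isUnitRep_topAxes h), h.op_apply, h.op_apply, inner_smul_left,
    inner_smul_right, ← inner_op_comm, ← inner_op_comm, h.inner_eq, h.inner_eq,
    if_neg (Fin.castSucc_lt_last a).ne, if_pos rfl] at heq
  rw [inv_mul_eq_div, eq_div_iff (sub_pos.2 hne).ne']
  simp at heq
  rw [← inner_op_comm] at heq
  linarith

end Derivative

/-! ### Compactness of the set of eigenframes. -/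

section Compactness

theorem isEigenFrame_iff {A : SymTuple m q} {d : Fin q → Fin (m + 1) → ℝ}
    {g : Fin q → Fin (m + 1) → Vec m} : IsEigenFrame A d g ↔
      (∀ s a b, a ≤ b → d s a ≤ d s b) ∧ (∀ s a b, ⟪g s a, g s b⟫ = if a = b then (1 : ℝ) else 0) ∧
        ∀ s a i, ∑ j, A.1 (s, i, j) * g s a j = d s a * g s a i := by
  refine ⟨fun h => ⟨fun s a b hab => h.monotone s hab, fun s a b => h.inner_eq s a b,
    fun s a i => congrFun (h.eigen s a) i⟩, fun h => ⟨fun s a b hab => h.1 s a b hab,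
    fun s => orthonormal_iff_ite.2 (h.2.1 s), fun s a => funext fun i => h.2.2 s a i⟩⟩

/-- The parameter space `X` is general because it will also carry second moments and an auxiliary
real number. -/
theorem isClosed_isEigenFrame {X : Type*} [TopologicalSpace X] {π : X → SymTuple m q}
    (hπ : Continuous π) (γ₀ : Fin q → Vec m) :
    IsClosed {z : X × (Fin q → Fin (m + 1) → ℝ) × (Fin q → Fin (m + 1) → Vec m) |
      IsEigenFrame (π z.1) z.2.1 z.2.2 ∧ ∀ s, 0 ≤ ⟪γ₀ s, z.2.2 s (Fin.last m)⟫} := by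
  have hg : ∀ s a, Continuous
      fun z : X × (Fin q → Fin (m + 1) → ℝ) × (Fin q → Fin (m + 1) → Vec m) => z.2.2 s a :=
    fun s a => by fun_prop
  have hA : ∀ k, Continuous
      fun z : X × (Fin q → Fin (m + 1) → ℝ) × (Fin q → Fin (m + 1) → Vec m) => (π z.1).1 k :=
    fun k => by fun_prop
  have hd : ∀ s a, Continuous
      fun z : X × (Fin q → Fin (m + 1) → ℝ) × (Fin q → Fin (m + 1) → Vec m) => z.2.1 s a :=
    fun s a => by fun_prop
  have hgi : ∀ s a i, Continuous
      fun z : X × (Fin q → Fin (m + 1) → ℝ) × (Fin q → Fin (m + 1) → Vec m) => z.2.2 s a i :=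
    fun s a i => (PiLp.continuous_apply 2 _ i).comp (hg s a)
  simp only [isEigenFrame_iff, Set.ofPred_and, Set.ofPred_forall]
  have h1 := fun s a b => isClosed_le (hd s a) (hd s b)
  have h2 := fun s a b => isClosed_eq ((hg s a).inner (𝕜 := ℝ) (hg s b))
    (continuous_const (y := if a = b then (1 : ℝ) else 0))
  have h3 := fun s a i => isClosed_eq
    (continuous_finsetSum Finset.univ fun j _ => (hA (s, i, j)).mul (hgi s a j))
    ((hd s a).mul (hgi s a i))
  have h4 := fun s => isClosed_le (continuous_const (y := (0 : ℝ)))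
    ((continuous_const (y := γ₀ s)).inner (𝕜 := ℝ) (hg s (Fin.last m)))
  exact ((isClosed_iInter fun s => isClosed_iInter fun a => isClosed_iInter fun b =>
    isClosed_iInter fun _ => h1 s a b).inter
    ((isClosed_iInter fun s => isClosed_iInter fun a => isClosed_iInter fun b => h2 s a b).inter
    (isClosed_iInter fun s => isClosed_iInter fun a => isClosed_iInter fun i => h3 s a i))).inter
    (isClosed_iInter h4)

/-- A crude bound; it confines the frames of nearby matrices to one compact set. -/
theorem IsEigenFrame.abs_eigenvalue_le {A : SymTuple m q} {d : Fin q → Fin (m + 1) → ℝ}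
    {g : Fin q → Fin (m + 1) → Vec m} (h : IsEigenFrame A d g) (s : Fin q) (a : Fin (m + 1)) :
    |d s a| ≤ (m + 1) * ((m + 1) * ‖A‖) := by
  have h1 : d s a = ⟪g s a, op A s (g s a)⟫ := by
    rw [h.inner_op_right, h.inner_eq, if_pos rfl, mul_one]
  have hg : ∀ i, |g s a i| ≤ 1 := fun i => by
    have := PiLp.norm_apply_le (g s a) i
    rwa [h.norm_eq_one, Real.norm_eq_abs] at this
  have hA : ∀ k, |A.1 k| ≤ ‖A‖ := fun k => PiLp.norm_apply_le A.1 k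
  rw [h1, inner_op_eq_sum]
  calc |∑ i, ∑ j, g s a i * A.1 (s, i, j) * g s a j|
      ≤ ∑ i : Fin (m + 1), ∑ j : Fin (m + 1), ‖A‖ := by
        refine (Finset.abs_sum_le_sum_abs _ _).trans (Finset.sum_le_sum fun i _ =>
          (Finset.abs_sum_le_sum_abs _ _).trans (Finset.sum_le_sum fun j _ => ?_))
        rw [abs_mul, abs_mul]
        calc |g s a i| * |A.1 (s, i, j)| * |g s a j| ≤ 1 * ‖A‖ * 1 := by
              gcongr
              exacts [hg i, hA _, hg j]
          _ = ‖A‖ := by ring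
    _ = (m + 1) * ((m + 1) * ‖A‖) := by simp

/-- Properties that hold near every eigenframe of `π x₀` hold for every eigenframe of `π x` for `x`
near `x₀`. -/
theorem eventually_forall_isEigenFrame {X : Type*} [TopologicalSpace X] {x₀ : X}
    {π : X → SymTuple m q} (hπ : Continuous π) (γ₀ : Fin q → Vec m)
    {Pr : X → (Fin q → Fin (m + 1) → ℝ) → (Fin q → Fin (m + 1) → Vec m) → Prop}
    (h : ∀ d g, IsEigenFrame (π x₀) d g → (∀ s, 0 ≤ ⟪γ₀ s, g s (Fin.last m)⟫) →
      ∀ᶠ z in 𝓝 (x₀, (d, g)), Pr z.1 z.2.1 z.2.2) :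
    ∀ᶠ x in 𝓝 x₀, ∀ d g, IsEigenFrame (π x) d g →
      (∀ s, 0 ≤ ⟪γ₀ s, g s (Fin.last m)⟫) → Pr x d g := by
  set R : ℝ := (m + 1) * ((m + 1) * (‖π x₀‖ + 1)) with hR
  set C : Set ((Fin q → Fin (m + 1) → ℝ) × (Fin q → Fin (m + 1) → Vec m)) :=
    (Set.univ.pi fun _ => Set.univ.pi fun _ => Set.Icc (-R) R) ×ˢ
      (Set.univ.pi fun _ => Set.univ.pi fun _ => Metric.closedBall 0 1) with hC
  have hCc : IsCompact C :=
    (isCompact_univ_pi fun _ => isCompact_univ_pi fun _ => isCompact_Icc).prod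
      (isCompact_univ_pi fun _ => isCompact_univ_pi fun _ => isCompact_closedBall _ _)
  -- Tube lemma: around a pair that is not an oriented eigenframe at `x₀`, closedness leaves no such
  -- frame in a neighborhood, so the implication is vacuous there.
  have key := hCc.eventually_forall_of_forall_eventually (x₀ := x₀)
    (P := fun x y => (IsEigenFrame (π x) y.1 y.2 ∧ ∀ s, 0 ≤ ⟪γ₀ s, y.2 s (Fin.last m)⟫) →
      Pr x y.1 y.2) (by
    rintro ⟨d, g⟩ -
    by_cases hf : IsEigenFrame (π x₀) d g ∧ ∀ s, 0 ≤ ⟪γ₀ s, g s (Fin.last m)⟫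
    · filter_upwards [h d g hf.1 hf.2] with z hz _ using hz
    · filter_upwards [(isClosed_isEigenFrame hπ γ₀).isOpen_compl.mem_nhds
        (show (x₀, (d, g)) ∈ _ from hf)] with z hz hz' using absurd hz' hz)
  have hnear : ∀ᶠ x in 𝓝 x₀, ‖π x‖ < ‖π x₀‖ + 1 :=
    (hπ.norm.tendsto x₀).eventually (gt_mem_nhds (lt_add_one _))
  filter_upwards [key, hnear] with x hx hxn d g hf hs
  refine hx (d, g) ⟨fun s _ a _ => ?_, fun s _ a _ => ?_⟩ ⟨hf, hs⟩
  · refine abs_le.1 ((hf.abs_eigenvalue_le s a).trans ?_)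
    rw [hR]; gcongr
  · simp [hf.norm_eq_one s a]

end Compactness

/-! ### Change of eigenframe and invariance of the weights. -/

section FrameMatrices

/-- Index set of the entries of a tuple of matrices. -/
abbrev EntryIdx (m q : ℕ) := Fin q × Fin (m + 1) × Fin (m + 1)

/-- The matrix taking the entries of `B` to the coordinates of `d P (B)` in an eigenframe. -/
noncomputable def frameMat (d : Fin q → Fin (m + 1) → ℝ) (g : Fin q → Fin (m + 1) → Vec m) :
    Matrix (EntryIdx m q) (Fin q × Fin m) ℝ :=
  Matrix.of fun k sa => if k.1 = sa.1 then
    (d sa.1 (Fin.last m) - d sa.1 sa.2.castSucc)⁻¹ *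
      (g sa.1 sa.2.castSucc k.2.1 * g sa.1 (Fin.last m) k.2.2) else 0

/-- The asymptotic covariance matrix in an eigenframe, from the second moments of the entries. -/
noncomputable def frameCov (K : Matrix (EntryIdx m q) (EntryIdx m q) ℝ)
    (d : Fin q → Fin (m + 1) → ℝ) (g : Fin q → Fin (m + 1) → Vec m) :
    Matrix (Fin q × Fin m) (Fin q × Fin m) ℝ :=
  (frameMat d g)ᵀ * K * frameMat d g

/-- The matrix with columns `(c_s - d_s(a))⁻¹ g_s(a)`. -/
noncomputable def resolventMat (c : Fin q → ℝ) (d : Fin q → Fin (m + 1) → ℝ)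
    (g : Fin q → Fin (m + 1) → Vec m) : Matrix (Fin q × Fin (m + 1)) (Fin q × Fin m) ℝ :=
  Matrix.of fun k sa => if k.1 = sa.1 then
    (c sa.1 - d sa.1 sa.2.castSucc)⁻¹ * g sa.1 sa.2.castSucc k.2 else 0

/-- The change of coordinates between two eigenframes. -/
noncomputable def transition (d : Fin q → Fin (m + 1) → ℝ) (g : Fin q → Fin (m + 1) → Vec m)
    (d' : Fin q → Fin (m + 1) → ℝ) (g' : Fin q → Fin (m + 1) → Vec m) :
    Matrix (Fin q × Fin m) (Fin q × Fin m) ℝ :=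
  Matrix.of fun sb ta => if sb.1 = ta.1 then
    (d ta.1 (Fin.last m) - d ta.1 sb.2.castSucc) *
      (d' ta.1 (Fin.last m) - d' ta.1 ta.2.castSucc)⁻¹ *
      (⟪g ta.1 (Fin.last m), g' ta.1 (Fin.last m)⟫ *
        ⟪g ta.1 sb.2.castSucc, g' ta.1 ta.2.castSucc⟫) else 0

theorem frameMat_transpose_mulVec (d : Fin q → Fin (m + 1) → ℝ)
    (g : Fin q → Fin (m + 1) → Vec m) (B : SymTuple m q) (sa : Fin q × Fin m) :
    ((frameMat d g)ᵀ *ᵥ B.1.ofLp) sa = (d sa.1 (Fin.last m) - d sa.1 sa.2.castSucc)⁻¹ *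
      ⟪g sa.1 sa.2.castSucc, op B sa.1 (g sa.1 (Fin.last m))⟫ := by
  rw [inner_op_eq_sum]
  simp only [Matrix.mulVec, dotProduct, Matrix.transpose_apply, Fintype.sum_prod_type, frameMat,
    Matrix.of_apply]
  rw [Finset.sum_eq_single sa.1]
  · simp only [if_true, Finset.mul_sum]
    refine Finset.sum_congr rfl fun i _ => Finset.sum_congr rfl fun j _ => by ring
  · intro s _ hs
    simp [hs]
  · simp

theorem resolventMat_transpose_mulVec (c : Fin q → ℝ) (d : Fin q → Fin (m + 1) → ℝ)
    (g : Fin q → Fin (m + 1) → Vec m) (w : Fin q → Vec m) (sa : Fin q × Fin m) :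
    ((resolventMat c d g)ᵀ *ᵥ fun k => w k.1 k.2) sa =
      (c sa.1 - d sa.1 sa.2.castSucc)⁻¹ * ⟪g sa.1 sa.2.castSucc, w sa.1⟫ := by
  rw [EuclideanSpace.inner_eq_star_dotProduct]
  simp only [Matrix.mulVec, dotProduct, Matrix.transpose_apply, Fintype.sum_prod_type,
    resolventMat, Matrix.of_apply, Pi.star_apply, star_trivial]
  rw [Finset.sum_eq_single sa.1]
  · simp only [if_true, Finset.mul_sum]
    refine Finset.sum_congr rfl fun i _ => by ring
  · intro s _ hs
    simp [hs]
  · simp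

variable {A : SymTuple m q} {d d' : Fin q → Fin (m + 1) → ℝ} {g g' : Fin q → Fin (m + 1) → Vec m}

/-- The nonleading vectors of one frame expanded in those of another one. -/
theorem IsEigenFrame.sum_inner_mul (hA : Nonfocal A) (h : IsEigenFrame A d g)
    (h' : IsEigenFrame A d' g') (s : Fin q) (a : Fin m) (x : Vec m) :
    ∑ b : Fin m, ⟪x, g s b.castSucc⟫ * ⟪g s b.castSucc, g' s a.castSucc⟫ =
      ⟪x, g' s a.castSucc⟫ := by
  have h0 : ⟪g s (Fin.last m), g' s a.castSucc⟫ = 0 := by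
    have h1 := h'.inner_eq s (Fin.last m) a.castSucc
    rw [if_neg (Fin.castSucc_lt_last a).ne'] at h1
    rcases h.last_eq_or_eq_neg hA h' s with h2 | h2
    · rwa [h2] at h1
    · rw [h2, inner_neg_left] at h1; linarith
  rw [← sum_inner_mul_inner_frame (h.orthonormal s) x, Fin.sum_univ_castSucc, h0, mul_zero,
    add_zero]

theorem IsEigenFrame.inner_last_mul (hA : Nonfocal A) (h : IsEigenFrame A d g)
    (h' : IsEigenFrame A d' g') (s : Fin q) (j : Fin (m + 1)) :
    g s (Fin.last m) j * ⟪g s (Fin.last m), g' s (Fin.last m)⟫ = g' s (Fin.last m) j := by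
  rcases h.last_eq_or_eq_neg hA h' s with h2 | h2 <;> simp [h2, h.norm_eq_one]

theorem vec_apply_eq_inner (x : Vec m) (i : Fin (m + 1)) :
    x i = ⟪EuclideanSpace.single i (1 : ℝ), x⟫ := by
  simp [EuclideanSpace.inner_single_left]

/-- The eigengaps in `transition` undo the old normalization and install the new one; the product of
leading vectors carries the sign. -/
theorem frameMat_mul_transition (hA : Nonfocal A) (h : IsEigenFrame A d g)
    (h' : IsEigenFrame A d' g') :
    frameMat d g * transition d g d' g' = frameMat d' g' := by
  ext ⟨t, i, j⟩ ⟨s, a⟩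
  rw [Matrix.mul_apply, Fintype.sum_prod_type, Finset.sum_eq_single t]
  · by_cases hts : t = s
    · subst hts
      simp only [frameMat, transition, Matrix.of_apply, if_true]
      rw [vec_apply_eq_inner (g' t a.castSucc) i, ← h.sum_inner_mul hA h',
        ← h.inner_last_mul hA h' t j, Finset.sum_mul, Finset.mul_sum]
      refine Finset.sum_congr rfl fun b _ => ?_
      have := (sub_pos.2 (h.lt_last hA t b)).ne'
      rw [← vec_apply_eq_inner]
      field_simp
    · simp [frameMat, transition, hts]
  · intro u _ hu
    simp [frameMat, Ne.symm hu]
  · simp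

/-- `resolventMat` contains no leading vector to absorb a sign, hence the condition that the leading
vectors agree. -/
theorem resolventMat_mul_transition (hA : Nonfocal A) (h : IsEigenFrame A d g)
    (h' : IsEigenFrame A d' g') (hlast : ∀ s, g' s (Fin.last m) = g s (Fin.last m)) :
    resolventMat (fun s => d s (Fin.last m)) d g * transition d g d' g' =
      resolventMat (fun s => d s (Fin.last m)) d' g' := by
  ext ⟨t, i⟩ ⟨s, a⟩
  rw [Matrix.mul_apply, Fintype.sum_prod_type, Finset.sum_eq_single t]
  · by_cases hts : t = s
    · subst hts
      simp only [resolventMat, transition, Matrix.of_apply, if_true, hlast, h.last_eq h']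
      rw [vec_apply_eq_inner (g' t a.castSucc) i, ← h.sum_inner_mul hA h', Finset.mul_sum]
      refine Finset.sum_congr rfl fun b _ => ?_
      have := (sub_pos.2 (h.lt_last hA t b)).ne'
      rw [← vec_apply_eq_inner, real_inner_self_eq_norm_sq, h.norm_eq_one]
      field_simp
    · simp [resolventMat, transition, hts]
  · intro u _ hu
    simp [resolventMat, Ne.symm hu]
  · simp

theorem transition_mul_transition (hA : Nonfocal A) (h : IsEigenFrame A d g)
    (h' : IsEigenFrame A d' g') : transition d g d' g' * transition d' g' d g = 1 := by
  ext ⟨s, b⟩ ⟨t, a⟩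
  rw [Matrix.mul_apply, Fintype.sum_prod_type, Finset.sum_eq_single s]
  · by_cases hst : s = t
    · subst hst
      have h1 : ∑ c : Fin m, ⟪g s b.castSucc, g' s c.castSucc⟫ * ⟪g' s c.castSucc, g s a.castSucc⟫
          = if b = a then 1 else 0 := by
        rw [h'.sum_inner_mul hA h, h.inner_eq]; simp
      have h2 : ⟪g s (Fin.last m), g' s (Fin.last m)⟫ * ⟪g' s (Fin.last m), g s (Fin.last m)⟫
          = 1 := by
        rcases h.last_eq_or_eq_neg hA h' s with h2 | h2 <;> simp [h2, h.norm_eq_one]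
      have h3 : (1 : Matrix (Fin q × Fin m) (Fin q × Fin m) ℝ) (s, b) (s, a) =
          (d s (Fin.last m) - d s b.castSucc) * (d s (Fin.last m) - d s a.castSucc)⁻¹ *
            (if b = a then 1 else 0) := by
        by_cases hba : b = a
        · subst hba
          simp [mul_inv_cancel₀ (sub_pos.2 (h.lt_last hA s b)).ne']
        · simp [hba]
      rw [h3, ← h1, Finset.mul_sum]
      refine Finset.sum_congr rfl fun c _ => ?_
      have h4 := (sub_pos.2 (h'.lt_last hA s c)).ne'
      simp only [transition, Matrix.of_apply, if_true]
      rw [show ∀ x y z w u v p r : ℝ, x * y * (u * p) * (z * w * (v * r)) =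
        (x * w * (p * r)) * (y * z) * (u * v) from fun _ _ _ _ _ _ _ _ => by ring, h2,
        inv_mul_cancel₀ h4]
      ring
    · simp [transition, hst]
  · intro u _ hu
    simp [transition, Ne.symm hu]
  · simp

theorem frameCov_eq_transition (hA : Nonfocal A) (h : IsEigenFrame A d g)
    (h' : IsEigenFrame A d' g') (K : Matrix (EntryIdx m q) (EntryIdx m q) ℝ) :
    frameCov K d' g' = (transition d g d' g')ᵀ * frameCov K d g * transition d g d' g' := by
  rw [frameCov, ← frameMat_mul_transition hA h h', frameCov, Matrix.transpose_mul]
  simp only [Matrix.mul_assoc]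

theorem frameCov_posDef (hA : Nonfocal A) (h : IsEigenFrame A d g)
    (h' : IsEigenFrame A d' g') {K : Matrix (EntryIdx m q) (EntryIdx m q) ℝ}
    (hK : (frameCov K d g).PosDef) : (frameCov K d' g').PosDef := by
  rw [frameCov_eq_transition hA h h']
  have hu : IsUnit (transition d g d' g') :=
    IsUnit.of_mul_eq_one _ (transition_mul_transition hA h h')
  exact hK.conjTranspose_mul_mul_same (Matrix.mulVec_injective_of_isUnit hu)

/-- The matrix of the quadratic form of the Hotelling statistic. -/
noncomputable def weightMat (c : Fin q → ℝ) (K : Matrix (EntryIdx m q) (EntryIdx m q) ℝ)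
    (d : Fin q → Fin (m + 1) → ℝ) (g : Fin q → Fin (m + 1) → Vec m) :
    Matrix (Fin q × Fin (m + 1)) (Fin q × Fin (m + 1)) ℝ :=
  resolventMat c d g * (frameCov K d g)⁻¹ * (resolventMat c d g)ᵀ

/-- With `R` the transition matrix, `W' = W R` and `G' = Rᵀ G R`, so `R` cancels from `W' G'⁻¹ W'ᵀ`.
-/
theorem weightMat_eq (hA : Nonfocal A) (h : IsEigenFrame A d g)
    (h' : IsEigenFrame A d' g') (hlast : ∀ s, g' s (Fin.last m) = g s (Fin.last m))
    (K : Matrix (EntryIdx m q) (EntryIdx m q) ℝ) :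
    weightMat (fun s => d s (Fin.last m)) K d' g' =
      weightMat (fun s => d s (Fin.last m)) K d g := by
  have h1 := transition_mul_transition hA h h'
  rw [weightMat, frameCov_eq_transition hA h h', ← resolventMat_mul_transition hA h h' hlast,
    Matrix.mul_inv_rev, Matrix.mul_inv_rev, Matrix.transpose_mul, weightMat,
    Matrix.inv_eq_right_inv h1, ← Matrix.transpose_nonsing_inv, Matrix.inv_eq_right_inv h1]
  set R := transition d g d' g'
  set S := transition d' g' d g
  have h2 : Sᵀ * Rᵀ = 1 := by rw [← Matrix.transpose_mul, h1, Matrix.transpose_one]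
  calc _ = resolventMat (fun s => d s (Fin.last m)) d g * (R * S) * (frameCov K d g)⁻¹ *
        (Sᵀ * Rᵀ) * (resolventMat (fun s => d s (Fin.last m)) d g)ᵀ := by
        simp only [Matrix.mul_assoc]
    _ = _ := by rw [h1, h2, Matrix.mul_one, Matrix.mul_one]

/-- The deviation vector in terms of the perturbation of the matrices. -/
theorem deviation_eq {A₀ : SymTuple m q} {d₀ : Fin q → Fin (m + 1) → ℝ}
    {g₀ : Fin q → Fin (m + 1) → Vec m} (h₀ : IsEigenFrame A₀ d₀ g₀) (h : IsEigenFrame A d g)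
    (hne : ∀ s (a : Fin m), d₀ s (Fin.last m) - d s a.castSucc ≠ 0) :
    deviation g (fun s => g₀ s (Fin.last m)) =
      -((resolventMat (fun s => d₀ s (Fin.last m)) d g)ᵀ *ᵥ
        fun k => op (A - A₀) k.1 (g₀ k.1 (Fin.last m)) k.2) := by
  ext ⟨s, a⟩
  rw [Pi.neg_apply, resolventMat_transpose_mulVec _ _ _
    (fun s => op (A - A₀) s (g₀ s (Fin.last m))) (s, a), inner_op_sub, h.inner_op_left,
    h₀.inner_op_right, deviation, real_inner_comm]
  -- What remains is that `g_s(a)ᵀ (A - A₀) γ_s` equals the difference of eigenvalues times `g_s(a)ᵀ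
  -- γ_s`, by applying `A` to the left factor and `A₀` to the right one.
  have := hne s a
  simp only
  field_simp
  ring

end FrameMatrices

/-! ### The statistic as a function of the first two moments. -/

section Statistic

/-- The matrix of the products of the entries of `j_k(p)`. -/
noncomputable def outer (p : Axes m q) : Matrix (EntryIdx m q) (EntryIdx m q) ℝ :=
  Matrix.vecMulVec (embed p).1.ofLp (embed p).1.ofLp

theorem transpose_mul_outer_mul {ι : Type*} (p : Axes m q) (F : Matrix (EntryIdx m q) ι ℝ) :
    Fᵀ * outer p * F =
      Matrix.vecMulVec (Fᵀ *ᵥ (embed p).1.ofLp) (Fᵀ *ᵥ (embed p).1.ofLp) := by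
  rw [outer, Matrix.mul_vecMulVec, Matrix.vecMulVec_mul, Matrix.mulVec_transpose]

/-- Each summand is a product of two entries of `x xᵀ` in the eigenframe, so the signs of the
representatives cancel and only second moments of the embedded data enter. -/
theorem sampleCov_eq (n : ℕ) (y : ℕ → Axes m q) (x : ℕ → Fin q → Vec m)
    (hx : ∀ r s, IsUnitRep (x r s) (y r s)) (d : Fin q → Fin (m + 1) → ℝ)
    (g : Fin q → Fin (m + 1) → Vec m) :
    sampleCov n x d g = frameCov ((n : ℝ)⁻¹ • ∑ r ∈ Finset.range n, outer (y r)) d g := by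
  ext sa tb
  rw [frameCov, Matrix.mul_smul, Matrix.smul_mul, Matrix.mul_sum, Matrix.sum_mul,
    Matrix.smul_apply, Matrix.sum_apply, sampleCov, Matrix.of_apply, smul_eq_mul, mul_assoc,
    mul_assoc, Finset.mul_sum, Finset.mul_sum]
  congr 1
  refine Finset.sum_congr rfl fun r _ => ?_
  rw [transpose_mul_outer_mul, Matrix.vecMulVec_apply, frameMat_transpose_mulVec,
    frameMat_transpose_mulVec, inner_op_embed (y r) (hx r), inner_op_embed (y r) (hx r)]
  ring

theorem hotelling_eq {A₀ A : SymTuple m q} {d₀ d : Fin q → Fin (m + 1) → ℝ}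
    {g₀ g : Fin q → Fin (m + 1) → Vec m} (h₀ : IsEigenFrame A₀ d₀ g₀) (h : IsEigenFrame A d g)
    (hne : ∀ s (a : Fin m), d₀ s (Fin.last m) - d s a.castSucc ≠ 0) (n : ℕ)
    (x : ℕ → Fin q → Vec m) {K : Matrix (EntryIdx m q) (EntryIdx m q) ℝ}
    (hK : sampleCov n x d g = frameCov K d g) :
    hotelling n x d g (fun s => g₀ s (Fin.last m)) =
      n * ((fun k => op (A - A₀) k.1 (g₀ k.1 (Fin.last m)) k.2) ⬝ᵥ
        (weightMat (fun s => d₀ s (Fin.last m)) K d g *ᵥ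
          fun k => op (A - A₀) k.1 (g₀ k.1 (Fin.last m)) k.2)) := by
  rw [hotelling, hK, deviation_eq h₀ h hne, weightMat, Matrix.mulVec_neg, neg_dotProduct_neg,
    ← Matrix.mulVec_mulVec, ← Matrix.mulVec_mulVec, Matrix.dotProduct_mulVec _ (resolventMat _ _ _),
    Matrix.mulVec_transpose]

end Statistic

/-! ### Continuity of the weights and of the quadratic form. -/

section Continuity

variable {X : Type*} [TopologicalSpace X] {x₀ : X}
  {D : X → Fin q → Fin (m + 1) → ℝ} {G : X → Fin q → Fin (m + 1) → Vec m}
  {K : X → Matrix (EntryIdx m q) (EntryIdx m q) ℝ}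

theorem continuousAt_frameMat (hD : ContinuousAt D x₀) (hG : ContinuousAt G x₀)
    (hne : ∀ s (a : Fin m), D x₀ s (Fin.last m) - D x₀ s a.castSucc ≠ 0) :
    ContinuousAt (fun x => frameMat (D x) (G x)) x₀ := by
  have hd : ∀ s a, ContinuousAt (fun x => D x s a) x₀ :=
    fun s a => continuousAt_pi.1 (continuousAt_pi.1 hD s) a
  have hg : ∀ s a i, ContinuousAt (fun x => G x s a i) x₀ := fun s a i =>
    (PiLp.continuous_apply 2 _ i).continuousAt.comp
      (continuousAt_pi.1 (continuousAt_pi.1 hG s) a)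
  refine continuousAt_pi.2 fun k => continuousAt_pi.2 fun sa => ?_
  by_cases hk : k.1 = sa.1
  · simp only [frameMat, Matrix.of_apply, if_pos hk]
    exact (((hd _ _).sub (hd _ _)).inv₀ (hne _ _)).mul ((hg _ _ _).mul (hg _ _ _))
  · simp only [frameMat, Matrix.of_apply, if_neg hk]
    exact continuousAt_const

theorem continuousAt_resolventMat (c : Fin q → ℝ) (hD : ContinuousAt D x₀)
    (hG : ContinuousAt G x₀) (hne : ∀ s (a : Fin m), c s - D x₀ s a.castSucc ≠ 0) :
    ContinuousAt (fun x => resolventMat c (D x) (G x)) x₀ := by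
  have hd : ∀ s a, ContinuousAt (fun x => D x s a) x₀ :=
    fun s a => continuousAt_pi.1 (continuousAt_pi.1 hD s) a
  have hg : ∀ s a i, ContinuousAt (fun x => G x s a i) x₀ := fun s a i =>
    (PiLp.continuous_apply 2 _ i).continuousAt.comp
      (continuousAt_pi.1 (continuousAt_pi.1 hG s) a)
  refine continuousAt_pi.2 fun k => continuousAt_pi.2 fun sa => ?_
  by_cases hk : k.1 = sa.1
  · simp only [resolventMat, Matrix.of_apply, if_pos hk]
    exact ((continuousAt_const.sub (hd _ _)).inv₀ (hne _ _)).mul (hg _ _ _)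
  · simp only [resolventMat, Matrix.of_apply, if_neg hk]
    exact continuousAt_const

theorem continuousAt_matrix_mul {l n o : Type*} [Fintype n] {B : X → Matrix l n ℝ}
    {C : X → Matrix n o ℝ} (hB : ContinuousAt B x₀) (hC : ContinuousAt C x₀) :
    ContinuousAt (fun x => B x * C x) x₀ :=
  ((continuous_fst.matrix_mul continuous_snd).tendsto
    ((B x₀, C x₀) : Matrix l n ℝ × Matrix n o ℝ)).comp (hB.prodMk_nhds hC)

theorem continuousAt_matrix_transpose {l n : Type*} {B : X → Matrix l n ℝ}
    (hB : ContinuousAt B x₀) : ContinuousAt (fun x => (B x)ᵀ) x₀ :=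
  (continuous_id.matrix_transpose.continuousAt (x := B x₀)).comp hB

theorem continuousAt_frameCov_inv (hD : ContinuousAt D x₀) (hG : ContinuousAt G x₀)
    (hK : ContinuousAt K x₀)
    (hne : ∀ s (a : Fin m), D x₀ s (Fin.last m) - D x₀ s a.castSucc ≠ 0)
    (hdet : (frameCov (K x₀) (D x₀) (G x₀)).det ≠ 0) :
    ContinuousAt (fun x => (frameCov (K x) (D x) (G x))⁻¹) x₀ := by
  have hF := continuousAt_frameMat hD hG hne
  have hC : ContinuousAt (fun x => frameCov (K x) (D x) (G x)) x₀ :=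
    continuousAt_matrix_mul (continuousAt_matrix_mul (continuousAt_matrix_transpose hF) hK) hF
  refine ContinuousAt.comp (f := fun x => frameCov (K x) (D x) (G x)) (g := fun M => M⁻¹) ?_ hC
  refine continuousAt_matrix_inv _ ?_
  rw [Ring.inverse_eq_inv']
  exact continuousAt_inv₀ hdet

theorem continuousAt_weightMat (c : Fin q → ℝ) (hD : ContinuousAt D x₀) (hG : ContinuousAt G x₀)
    (hK : ContinuousAt K x₀)
    (hne : ∀ s (a : Fin m), D x₀ s (Fin.last m) - D x₀ s a.castSucc ≠ 0)
    (hc : ∀ s (a : Fin m), c s - D x₀ s a.castSucc ≠ 0)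
    (hdet : (frameCov (K x₀) (D x₀) (G x₀)).det ≠ 0) :
    ContinuousAt (fun x => weightMat c (K x) (D x) (G x)) x₀ := by
  have hW := continuousAt_resolventMat c hD hG hc
  exact continuousAt_matrix_mul (continuousAt_matrix_mul hW
    (continuousAt_frameCov_inv hD hG hK hne hdet)) (continuousAt_matrix_transpose hW)

theorem eventually_weightMat_sub_lt (c : Fin q → ℝ) (hD : ContinuousAt D x₀)
    (hG : ContinuousAt G x₀) (hK : ContinuousAt K x₀)
    (hne : ∀ s (a : Fin m), D x₀ s (Fin.last m) - D x₀ s a.castSucc ≠ 0)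
    (hc : ∀ s (a : Fin m), c s - D x₀ s a.castSucc ≠ 0)
    (hdet : (frameCov (K x₀) (D x₀) (G x₀)).det ≠ 0) {ε : ℝ} (hε : 0 < ε) :
    ∀ᶠ x in 𝓝 x₀, (∀ s (a : Fin m), c s - D x s a.castSucc ≠ 0) ∧
      ∀ k l, |weightMat c (K x) (D x) (G x) k l -
        weightMat c (K x₀) (D x₀) (G x₀) k l| < ε := by
  have hcont := continuousAt_weightMat c hD hG hK hne hc hdet
  refine (eventually_all.2 fun s => eventually_all.2 fun a => ?_).and
    (eventually_all.2 fun k => eventually_all.2 fun l => ?_)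
  · exact (continuousAt_const.sub
      (continuousAt_pi.1 (continuousAt_pi.1 hD s) _)).eventually_ne (hc s a)
  · exact (continuousAt_pi.1 (continuousAt_pi.1 hcont k) l).tendsto (Metric.ball_mem_nhds _ hε)

theorem continuousAt_deviation_form (γ₀ : Fin q → Vec m) (hD : ContinuousAt D x₀)
    (hG : ContinuousAt G x₀) (hK : ContinuousAt K x₀)
    (hne : ∀ s (a : Fin m), D x₀ s (Fin.last m) - D x₀ s a.castSucc ≠ 0)
    (hdet : (frameCov (K x₀) (D x₀) (G x₀)).det ≠ 0) :
    ContinuousAt (fun x => deviation (G x) γ₀ ⬝ᵥ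
      ((frameCov (K x) (D x) (G x))⁻¹ *ᵥ deviation (G x) γ₀)) x₀ := by
  have hinv := continuousAt_frameCov_inv hD hG hK hne hdet
  have hdc : ∀ sa, ContinuousAt (fun x => deviation (G x) γ₀ sa) x₀ := fun sa =>
    continuousAt_const.inner (𝕜 := ℝ) (continuousAt_pi.1 (continuousAt_pi.1 hG sa.1) _)
  exact tendsto_finsetSum _ fun sa _ => (hdc sa).mul
    (tendsto_finsetSum _ fun tb _ => (continuousAt_pi.1 (continuousAt_pi.1 hinv sa) tb).mul (hdc tb))

end Continuity

/-! ### Estimates uniform over all eigenframes. -/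

section Neighborhoods

variable {A₀ : SymTuple m q} {d₀ : Fin q → Fin (m + 1) → ℝ} {g₀ : Fin q → Fin (m + 1) → Vec m}
  {K₀ : EntryIdx m q → EntryIdx m q → ℝ}

/-- Near the population moments, the quadratic form of the Hotelling statistic is close to its
limit, whatever eigenframe is chosen. -/
theorem eventually_weightMat_close (hA : Nonfocal A₀) (h₀ : IsEigenFrame A₀ d₀ g₀)
    (hpos : (frameCov (Matrix.of K₀) d₀ g₀).PosDef) {ε : ℝ} (hε : 0 < ε) :
    ∀ᶠ x in 𝓝 (A₀, K₀), ∀ d g, IsEigenFrame x.1 d g →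
      (∀ s, 0 ≤ ⟪g₀ s (Fin.last m), g s (Fin.last m)⟫) →
        (∀ s (a : Fin m), d₀ s (Fin.last m) - d s a.castSucc ≠ 0) ∧
        ∀ k l, |weightMat (fun s => d₀ s (Fin.last m)) (Matrix.of x.2) d g k l -
          weightMat (fun s => d₀ s (Fin.last m)) (Matrix.of K₀) d₀ g₀ k l| < ε := by
  refine eventually_forall_isEigenFrame (π := Prod.fst) continuous_fst
    (fun s => g₀ s (Fin.last m)) (Pr := fun x d g =>
        (∀ s (a : Fin m), d₀ s (Fin.last m) - d s a.castSucc ≠ 0) ∧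
        ∀ k l, |weightMat (fun s => d₀ s (Fin.last m)) (Matrix.of x.2) d g k l -
          weightMat (fun s => d₀ s (Fin.last m)) (Matrix.of K₀) d₀ g₀ k l| < ε)
    fun d g h hs => ?_
  have hlast : ∀ s, g s (Fin.last m) = g₀ s (Fin.last m) := by
    intro s
    rcases h₀.last_eq_or_eq_neg hA h s with h1 | h1
    · exact h1
    · have := hs s
      rw [h1, inner_neg_right, real_inner_self_eq_norm_sq, h₀.norm_eq_one] at this
      norm_num at this
  have hne : ∀ s (a : Fin m), d s (Fin.last m) - d s a.castSucc ≠ 0 :=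
    fun s a => (sub_pos.2 (h.lt_last hA s a)).ne'
  have hc : ∀ s (a : Fin m), d₀ s (Fin.last m) - d s a.castSucc ≠ 0 := fun s a => by
    rw [← h₀.last_eq h s]; exact hne s a
  have hdet : (frameCov (Matrix.of K₀) d g).det ≠ 0 := (frameCov_posDef hA h₀ h hpos).det_pos.ne'
  -- Continuity at the frame `(d, g)` compares with the weights of that frame; invariance replaces
  -- them by those of `(d₀, g₀)`.
  have hQ := weightMat_eq hA h₀ h hlast (Matrix.of K₀)
  have key := eventually_weightMat_sub_lt (x₀ := ((A₀, K₀), (d, g))) (D := fun z => z.2.1)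
    (G := fun z => z.2.2) (K := fun z => Matrix.of z.1.2) (fun s => d₀ s (Fin.last m))
    (by fun_prop) (by fun_prop) (continuous_snd.comp continuous_fst).continuousAt hne hc hdet hε
  simp only [hQ] at key
  exact key

/-- If the axes of `γ₀` are not the extrinsic mean, the normalized Hotelling statistic is bounded
away from zero near the population moments. -/
theorem exists_eventually_lt_hotelling (hA : Nonfocal A₀) (h₀ : IsEigenFrame A₀ d₀ g₀)
    (hpos : (frameCov (Matrix.of K₀) d₀ g₀).PosDef) {μ₀ : Axes m q} {γ₀ : Fin q → Vec m}
    (hγ₀ : ∀ s, IsUnitRep (γ₀ s) (μ₀ s)) (hμ : nearest A₀ hA ≠ μ₀) :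
    ∃ c > 0, ∀ᶠ x in 𝓝 (A₀, K₀), ∀ d g, IsEigenFrame x.1 d g →
      (∀ s, 0 ≤ ⟪γ₀ s, g s (Fin.last m)⟫) →
        c < deviation g γ₀ ⬝ᵥ ((frameCov (Matrix.of x.2) d g)⁻¹ *ᵥ deviation g γ₀) := by
  -- The threshold is an extra real parameter with base value `0`; its neighborhood of `0` then
  -- supplies one positive `c` for all frames.
  have key := eventually_forall_isEigenFrame (x₀ := ((A₀, K₀), (0 : ℝ)))
    (π := fun x => x.1.1) (by fun_prop) γ₀ (Pr := fun x d g =>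
      x.2 < deviation g γ₀ ⬝ᵥ ((frameCov (Matrix.of x.1.2) d g)⁻¹ *ᵥ deviation g γ₀))
    fun d g h hs => by
      -- A vector orthogonal to all nonleading eigenvectors spans the leading axis; if this held for
      -- every `s`, the mean would be `μ₀`.
      have hdev : deviation g γ₀ ≠ 0 := by
        intro h0
        refine hμ ?_
        rw [nearest_eq_topAxes hA h]
        funext s
        refine IsUnitRep.eq_axis (x := γ₀ s) ⟨(hγ₀ s).1, ?_⟩ (hγ₀ s)
        have h1 : γ₀ s = ⟪γ₀ s, g s (Fin.last m)⟫ • g s (Fin.last m) := by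
          refine ext_inner_right ℝ fun v => ?_
          rw [← sum_inner_mul_inner_frame (h.orthonormal s), Fin.sum_univ_castSucc,
            Finset.sum_eq_zero, zero_add, inner_smul_left]
          · rfl
          · intro a _
            have := congrFun h0 (s, a)
            simp only [deviation, Pi.zero_apply] at this
            rw [this, zero_mul]
        rw [h1, topAxes, Projectivization.submodule_mk]
        exact Submodule.smul_mem _ _ (Submodule.mem_span_singleton_self _)
      have hne : ∀ s (a : Fin m), d s (Fin.last m) - d s a.castSucc ≠ 0 :=
        fun s a => (sub_pos.2 (h.lt_last hA s a)).ne'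
      have hG := frameCov_posDef hA h₀ h hpos
      have hval : 0 < deviation g γ₀ ⬝ᵥ
          ((frameCov (Matrix.of K₀) d g)⁻¹ *ᵥ deviation g γ₀) := by
        simpa using hG.inv.dotProduct_mulVec_pos hdev
      have hcont := continuousAt_deviation_form (x₀ := (((A₀, K₀), (0 : ℝ)), (d, g)))
        (D := fun z => z.2.1) (G := fun z => z.2.2) (K := fun z => Matrix.of z.1.1.2) γ₀
        (by fun_prop) (by fun_prop)
        (continuous_snd.comp (continuous_fst.comp continuous_fst)).continuousAt hne hG.det_pos.ne'
      exact ContinuousAt.eventually_lt (continuous_snd.comp continuous_fst).continuousAt hcont hval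
  rw [nhds_prod_eq] at key
  obtain ⟨pa, hpa, pb, hpb, hab⟩ := eventually_prod_iff.1 key
  obtain ⟨c, hc1, hc2⟩ := ((hpb.filter_mono nhdsWithin_le_nhds).and
    (self_mem_nhdsWithin (s := Set.Ioi (0 : ℝ)))).exists
  exact ⟨c, hc2, hpa.mono fun x hx => hab hx hc1⟩

/-- The leading vectors of an eigenframe may be replaced by other representatives. -/
theorem exists_isEigenFrame_last (hA : Nonfocal A₀) (h₀ : IsEigenFrame A₀ d₀ g₀)
    {γ₀ : Fin q → Vec m} (hγ₀ : ∀ s, IsUnitRep (γ₀ s) (nearest A₀ hA s)) :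
    ∃ g, IsEigenFrame A₀ d₀ g ∧ (fun s => g s (Fin.last m)) = γ₀ := by
  have hsgn : ∀ s, ∃ e : ℝ, e * e = 1 ∧ γ₀ s = e • g₀ s (Fin.last m) := by
    intro s
    have h1 := hγ₀ s
    rw [nearest_eq_topAxes hA h₀] at h1
    rcases h1.eq_or_eq_neg (isUnitRep_topAxes h₀ s) with h2 | h2
    · exact ⟨1, by norm_num, by rw [h2, one_smul]⟩
    · exact ⟨-1, by norm_num, by rw [h2, neg_one_smul]⟩
  choose e he hγ using hsgn
  obtain ⟨h1, h2, h3⟩ := isEigenFrame_iff.1 h₀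
  refine ⟨fun s a => (if a = Fin.last m then e s else 1) • g₀ s a, isEigenFrame_iff.2
    ⟨h1, fun s a b => ?_, fun s a i => ?_⟩, funext fun s => by simp [hγ]⟩
  · rw [inner_smul_left, inner_smul_right, h2]
    by_cases hab : a = b
    · subst hab
      by_cases ha : a = Fin.last m <;> simp [ha, he]
    · simp [hab]
  · simp only [PiLp.smul_apply, smul_eq_mul]
    rw [mul_left_comm, ← h3, Finset.mul_sum]
    refine Finset.sum_congr rfl fun j _ => by ring

end Neighborhoods

/-! ### Measurability and boundedness of the moments. -/

section Measurability

/-- `unitRep` is an arbitrary choice of sign, but the products do not see it and descend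
continuously to the quotient. -/
theorem continuous_unitRep_mul (i j : Fin (m + 1)) :
    Continuous fun p : RP m => unitRep p i * unitRep p j := by
  have hq : IsQuotientMap (Projectivization.mk' ℝ : {v : Vec m // v ≠ 0} → RP m) :=
    isQuotientMap_quotient_mk'
  rw [hq.continuous_iff]
  have : (fun p : RP m => unitRep p i * unitRep p j) ∘ Projectivization.mk' ℝ =
      fun v : {v : Vec m // v ≠ 0} => (‖v.1‖⁻¹ * v.1 i) * (‖v.1‖⁻¹ * v.1 j) := by
    funext v
    have hrep : IsUnitRep (‖v.1‖⁻¹ • v.1) (Projectivization.mk' ℝ v) := by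
      refine ⟨by rw [norm_smul, norm_inv, norm_norm, inv_mul_cancel₀ (norm_ne_zero_iff.2 v.2)], ?_⟩
      rw [Projectivization.mk'_eq_mk, Projectivization.submodule_mk]
      exact Submodule.smul_mem _ _ (Submodule.mem_span_singleton_self _)
    simpa using (isUnitRep_unitRep (Projectivization.mk' ℝ v)).mul_eq_mul hrep i j
  rw [this]
  have hn : Continuous fun v : {v : Vec m // v ≠ 0} => ‖v.1‖⁻¹ :=
    (continuous_norm.comp continuous_subtype_val).inv₀ fun v => norm_ne_zero_iff.2 v.2
  have hc : ∀ i, Continuous fun v : {v : Vec m // v ≠ 0} => v.1 i :=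
    fun i => (PiLp.continuous_apply 2 _ i).comp continuous_subtype_val
  exact (hn.mul (hc i)).mul (hn.mul (hc j))

theorem measurable_embed_apply (k : EntryIdx m q) :
    Measurable fun p : Axes m q => (embed p).1 k :=
  (continuous_unitRep_mul k.2.1 k.2.2).measurable.comp (measurable_pi_apply k.1)

theorem measurable_embed : Measurable (embed : Axes m q → SymTuple m q) :=
  Measurable.subtype_mk ((WithLp.measurable_toLp 2 _).comp
    (measurable_pi_lambda _ fun k => measurable_embed_apply k))

theorem abs_embed_apply_le (p : Axes m q) (k : EntryIdx m q) : |(embed p).1 k| ≤ 1 := by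
  have h : ∀ i, |unitRep (p k.1) i| ≤ 1 := fun i => by
    have := PiLp.norm_apply_le (unitRep (p k.1)) i
    rwa [(isUnitRep_unitRep (p k.1)).1, Real.norm_eq_abs] at this
  change |unitRep (p k.1) k.2.1 * unitRep (p k.1) k.2.2| ≤ 1
  rw [abs_mul]
  exact mul_le_one₀ (h _) (abs_nonneg _) (h _)

/-- The first and second moments `j_k(p)` and `j_k(p) ⊗ j_k(p)`. -/
noncomputable def moments (p : Axes m q) : SymTuple m q × (EntryIdx m q → EntryIdx m q → ℝ) :=
  (embed p, fun k l => (embed p).1 k * (embed p).1 l)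

theorem measurable_moments : Measurable (moments : Axes m q → _) :=
  measurable_embed.prodMk (measurable_pi_lambda _ fun k => measurable_pi_lambda _ fun l =>
    (measurable_embed_apply k).mul (measurable_embed_apply l))

theorem norm_moments_le (p : Axes m q) : ‖moments p‖ ≤ √q + 1 := by
  refine max_le ?_ ?_
  · have : ‖embed p‖ = √q := by rw [← norm_embed_sq p, Real.sqrt_sq (norm_nonneg _)]
    change ‖embed p‖ ≤ _
    linarith
  · have h0 : (0 : ℝ) ≤ √q := Real.sqrt_nonneg _
    refine (pi_norm_le_iff_of_nonneg (by positivity)).2 fun k =>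
      (pi_norm_le_iff_of_nonneg (by positivity)).2 fun l => ?_
    change |(embed p).1 k * (embed p).1 l| ≤ _
    rw [abs_mul]
    have := mul_le_one₀ (abs_embed_apply_le p k) (abs_nonneg _) (abs_embed_apply_le p l)
    linarith

end Measurability

/-- Distinct vectors of an eigenframe are orthogonal. Hence the tangent coordinates are centered,
and uncentered second moments already give the covariance. -/
theorem frameMat_transpose_mulVec_self {A : SymTuple m q} {d : Fin q → Fin (m + 1) → ℝ}
    {g : Fin q → Fin (m + 1) → Vec m} (h : IsEigenFrame A d g) :
    (frameMat d g)ᵀ *ᵥ A.1.ofLp = 0 := by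
  funext sa
  rw [frameMat_transpose_mulVec, h.inner_op_right, h.inner_eq,
    if_neg (Fin.castSucc_lt_last _).ne]
  simp

/-! ### Law of large numbers, variances and the extrinsic covariance. -/

section Sampling

variable {Ω : Type*} [MeasurableSpace Ω] {P : Measure Ω} [IsProbabilityMeasure P]
  {Y : ℕ → Ω → Axes m q}

/-- The law of large numbers, in probability. -/
theorem tendsto_average_notMem {E : Type*} [NormedAddCommGroup E] [NormedSpace ℝ E]
    [CompleteSpace E] [MeasurableSpace E] [BorelSpace E] [SecondCountableTopology E]
    (hY : ∀ r, Measurable (Y r)) (hindep : iIndepFun Y P)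
    (hident : ∀ r, IdentDistrib (Y r) (Y 0) P P) {F : Axes m q → E} (hF : Measurable F)
    {C : ℝ} (hC : ∀ p, ‖F p‖ ≤ C) {U : Set E} (hU : U ∈ 𝓝 (∫ ω, F (Y 0 ω) ∂P)) :
    Tendsto (fun n : ℕ => P.real {ω | (n : ℝ)⁻¹ • ∑ r ∈ Finset.range n, F (Y r ω) ∉ U})
      atTop (𝓝 0) := by
  have hm : ∀ r, Measurable fun ω => F (Y r ω) := fun r => hF.comp (hY r)
  have hint : Integrable (fun ω => F (Y 0 ω)) P :=
    Integrable.of_bound (hm 0).aestronglyMeasurable C (.of_forall fun ω => hC _)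
  have hslln := strong_law_ae (μ := P) (fun r ω => F (Y r ω)) hint
    (fun i j hij => (hindep.indepFun hij).comp hF hF) fun r => (hident r).comp hF
  have hmeas := tendstoInMeasure_of_tendsto_ae (fun n : ℕ =>
    ((Finset.measurable_fun_sum (Finset.range n) fun r _ => hm r).const_smul
      (n : ℝ)⁻¹).aestronglyMeasurable) hslln
  obtain ⟨ε, hε, hball⟩ := Metric.mem_nhds_iff.1 hU
  have h1 := tendstoInMeasure_iff_measureReal_dist.1 hmeas ε hε
  refine squeeze_zero (fun n => measureReal_nonneg) (fun n => measureReal_mono fun ω hω => ?_) h1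
  by_contra hcon
  exact hω (hball (Metric.mem_ball.2 (not_le.1 hcon)))

/-- By independence, the variance of a mean is `1 / n` times that of one term. This bound feeds
Markov's inequality. -/
theorem integral_scaled_average_sq_le (hY : ∀ r, Measurable (Y r)) (hindep : iIndepFun Y P)
    (hident : ∀ r, IdentDistrib (Y r) (Y 0) P P) {f : Axes m q → ℝ} (hf : Measurable f)
    {C : ℝ} (hC : ∀ p, |f p| ≤ C) (h0 : ∫ ω, f (Y 0 ω) ∂P = 0) (n : ℕ) :
    ∫ ω, n * ((n : ℝ)⁻¹ * ∑ r ∈ Finset.range n, f (Y r ω)) ^ 2 ∂P ≤ C ^ 2 := by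
  have hm : ∀ r, Measurable fun ω => f (Y r ω) := fun r => hf.comp (hY r)
  have hL : ∀ r, MemLp (fun ω => f (Y r ω)) 2 P := fun r =>
    MemLp.of_bound (hm r).aestronglyMeasurable C (.of_forall fun ω => hC _)
  have hid : ∀ r, IdentDistrib (fun ω => f (Y r ω)) (fun ω => f (Y 0 ω)) P P :=
    fun r => (hident r).comp hf
  have hvar := IndepFun.variance_sum (μ := P) (X := fun r ω => f (Y r ω)) (s := Finset.range n)
    (fun r _ => hL r) fun i _ j _ hij => (hindep.indepFun hij).comp hf hf
  have hmean : ∫ ω, (∑ r ∈ Finset.range n, fun ω => f (Y r ω)) ω ∂P = 0 := by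
    simp only [Finset.sum_apply]
    rw [integral_finsetSum _ fun r _ => (hL r).integrable (by norm_num)]
    exact Finset.sum_eq_zero fun r _ => (hid r).integral_eq.trans h0
  have hv0 : Var[fun ω => f (Y 0 ω); P] ≤ C ^ 2 := by
    rw [variance_of_integral_eq_zero (hm 0).aemeasurable h0]
    calc ∫ ω, f (Y 0 ω) ^ 2 ∂P ≤ ∫ _, C ^ 2 ∂P :=
          integral_mono (hL 0).integrable_sq (integrable_const _) fun _ =>
            sq_le_sq' (abs_le.1 (hC _)).1 (abs_le.1 (hC _)).2
      _ = C ^ 2 := by simp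
  rw [variance_of_integral_eq_zero (by fun_prop) hmean,
    Finset.sum_congr rfl fun r _ => (hid r).variance_eq, Finset.sum_const, Finset.card_range,
    nsmul_eq_mul] at hvar
  simp only [Finset.sum_apply] at hvar
  simp only [mul_pow]
  rw [integral_const_mul, integral_const_mul, hvar]
  rcases eq_or_ne n 0 with rfl | hn
  · simpa using sq_nonneg C
  · have : (n : ℝ) ≠ 0 := Nat.cast_ne_zero.2 hn
    field_simp
    exact hv0

omit [IsProbabilityMeasure P] in
theorem integrable_scaled_average_sq [IsFiniteMeasure P] (hY : ∀ r, Measurable (Y r))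
    {f : Axes m q → ℝ} (hf : Measurable f) {C : ℝ} (hC : ∀ p, |f p| ≤ C) (n : ℕ) :
    Integrable (fun ω => n * ((n : ℝ)⁻¹ * ∑ r ∈ Finset.range n, f (Y r ω)) ^ 2) P := by
  have hL : ∀ r, MemLp (fun ω => f (Y r ω)) 2 P := fun r =>
    MemLp.of_bound (hf.comp (hY r)).aestronglyMeasurable C (.of_forall fun ω => hC _)
  have hS : MemLp (fun ω => ∑ r ∈ Finset.range n, f (Y r ω)) 2 P :=
    memLp_finsetSum _ fun r _ => hL r
  exact (hS.const_mul _).integrable_sq.const_mul _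

variable (P Y) in
/-- The matrix of the second moments of the entries of `j_k(Y)`. -/
noncomputable def secondMoment : EntryIdx m q → EntryIdx m q → ℝ :=
  (∫ ω, moments (Y 0 ω) ∂P).2

theorem integrable_moments (hY : ∀ r, Measurable (Y r)) :
    Integrable (fun ω => moments (Y 0 ω)) P :=
  Integrable.of_bound (measurable_moments.comp (hY 0)).aestronglyMeasurable _
    (.of_forall fun _ => norm_moments_le _)

theorem integral_moments (hY : ∀ r, Measurable (Y r)) :
    ∫ ω, moments (Y 0 ω) ∂P = (meanEmbed P (Y 0), secondMoment P Y) :=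
  Prod.ext (fst_integral (integrable_moments hY)) rfl

theorem integral_dotProduct_embed (hY : ∀ r, Measurable (Y r)) (v : EntryIdx m q → ℝ) :
    ∫ ω, v ⬝ᵥ (embed (Y 0 ω)).1.ofLp ∂P = v ⬝ᵥ (meanEmbed P (Y 0)).1.ofLp := by
  let L : SymTuple m q →ₗ[ℝ] ℝ :=
    { toFun := fun A => v ⬝ᵥ A.1.ofLp
      map_add' := fun A B => by simp [dotProduct_add]
      map_smul' := fun c A => by simp [dotProduct_smul] }
  exact (LinearMap.toContinuousLinearMap L).integral_comp_comm (integrable_moments hY).fst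

theorem integral_dotProduct_mul_dotProduct (hY : ∀ r, Measurable (Y r))
    (v w : EntryIdx m q → ℝ) :
    ∫ ω, (v ⬝ᵥ (embed (Y 0 ω)).1.ofLp) * (w ⬝ᵥ (embed (Y 0 ω)).1.ofLp) ∂P =
      v ⬝ᵥ (Matrix.of (secondMoment P Y) *ᵥ w) := by
  let L : (SymTuple m q × (EntryIdx m q → EntryIdx m q → ℝ)) →ₗ[ℝ] ℝ :=
    { toFun := fun x => v ⬝ᵥ (Matrix.of x.2 *ᵥ w)
      map_add' := fun x y => by
        rw [Prod.snd_add, ← Matrix.of_add_of, Matrix.add_mulVec, dotProduct_add]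
      map_smul' := fun c x => by
        rw [Prod.smul_snd, ← Matrix.smul_of, Matrix.smul_mulVec, dotProduct_smul]; rfl }
  refine Eq.trans (integral_congr_ae (.of_forall fun ω => ?_))
    ((LinearMap.toContinuousLinearMap L).integral_comp_comm (integrable_moments hY))
  change _ = v ⬝ᵥ (Matrix.vecMulVec (embed (Y 0 ω)).1.ofLp (embed (Y 0 ω)).1.ofLp *ᵥ w)
  rw [Matrix.vecMulVec_mulVec, dotProduct_smul]
  simp [dotProduct_comm]

/-- The extrinsic covariance matrix in terms of the second moments. -/
theorem extrinsicCov_eq_frameCov (hY : ∀ r, Measurable (Y r)) {d : Fin q → Fin (m + 1) → ℝ}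
    {g : Fin q → Fin (m + 1) → Vec m} (h : IsEigenFrame (meanEmbed P (Y 0)) d g)
    (hA : Nonfocal (meanEmbed P (Y 0)))
    (hdiff : DifferentiableAt ℝ proj (meanEmbed P (Y 0))) :
    extrinsicCov P (Y 0) g = frameCov (Matrix.of (secondMoment P Y)) d g := by
  have hcoord : ∀ sa ω, tangentCoord g sa (fderiv ℝ proj (meanEmbed P (Y 0)) (embed (Y 0 ω))) =
      (frameMat d g)ᵀ sa ⬝ᵥ (embed (Y 0 ω)).1.ofLp := fun sa ω => by
    rw [tangentCoord_fderiv_proj h hA hdiff, ← frameMat_transpose_mulVec]; rfl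
  have hmean : ∀ sa, ∫ ω, (frameMat d g)ᵀ sa ⬝ᵥ (embed (Y 0 ω)).1.ofLp ∂P = 0 := fun sa => by
    rw [integral_dotProduct_embed hY]
    exact congrFun (frameMat_transpose_mulVec_self h) sa
  have hL : ∀ v : EntryIdx m q → ℝ, MemLp (fun ω => v ⬝ᵥ (embed (Y 0 ω)).1.ofLp) 2 P := by
    intro v
    refine MemLp.of_bound (C := ∑ k, |v k|) ?_ (.of_forall fun ω => ?_)
    · exact (Finset.measurable_fun_sum _ fun k _ =>
        ((measurable_embed_apply k).comp (hY 0)).const_mul (v k)).aestronglyMeasurable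
    · refine (Finset.abs_sum_le_sum_abs _ _).trans (Finset.sum_le_sum fun k _ => ?_)
      rw [abs_mul]
      exact mul_le_of_le_one_right (abs_nonneg _) (abs_embed_apply_le _ k)
  ext sa tb
  rw [extrinsicCov, Matrix.of_apply]
  simp only [hcoord]
  rw [covariance_eq_sub (hL _) (hL _), hmean, hmean, mul_zero, sub_zero]
  refine (integral_dotProduct_mul_dotProduct hY _ _).trans ?_
  rw [frameCov, Matrix.mul_assoc]
  rfl

/-- Positive definiteness of the extrinsic covariance matrix, in terms of the second moments. -/
theorem frameCov_posDef_of_extrinsicCov (hm : 1 ≤ m) (hq : 1 ≤ q) (hY : ∀ r, Measurable (Y r))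
    {d : Fin q → Fin (m + 1) → ℝ} {g : Fin q → Fin (m + 1) → Vec m}
    (h : IsEigenFrame (meanEmbed P (Y 0)) d g) (hA : Nonfocal (meanEmbed P (Y 0)))
    (hpos : (extrinsicCov P (Y 0) g).PosDef) :
    (frameCov (Matrix.of (secondMoment P Y)) d g).PosDef := by
  rw [← extrinsicCov_eq_frameCov hY h hA]
  · exact hpos
  -- positive definiteness forces differentiability: otherwise the covariance matrix is zero
  by_contra hdiff
  have h0 : extrinsicCov P (Y 0) g = 0 := by
    ext sa tb
    rw [extrinsicCov, Matrix.of_apply, fderiv_zero_of_not_differentiableAt hdiff]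
    simp [tangentCoord]
  have := hpos.diag_pos (i := (⟨0, hq⟩, ⟨0, hm⟩))
  rw [h0] at this
  simp at this

end Sampling

/-! ### Whitening of a covariance matrix. -/

section Whitening

open scoped MatrixOrder Matrix.Norms.L2Operator in
theorem exists_whitening {ι : Type*} [Fintype ι] [DecidableEq ι] {G : Matrix ι ι ℝ}
    (hG : G.PosDef) : ∃ B : Matrix ι ι ℝ, G⁻¹ = Bᵀ * B ∧ B * G * Bᵀ = 1 := by
  obtain ⟨B, hB⟩ := CStarAlgebra.nonneg_iff_eq_star_mul_self.mp hG.inv.posSemidef.nonneg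
  have hB' : G⁻¹ = Bᵀ * B := hB
  refine ⟨B, hB', ?_⟩
  have h1 : Bᵀ * (B * G) = 1 := by
    rw [← Matrix.mul_assoc, ← hB', Matrix.nonsing_inv_mul _ hG.det_pos.ne'.isUnit]
  exact mul_eq_one_comm.1 h1

end Whitening

/-! ### Limit of the quadratic form and tightness of the perturbation. -/

section Limits

variable {Ω : Type*} [MeasurableSpace Ω] {P : Measure Ω} [IsProbabilityMeasure P]
  {Y : ℕ → Ω → Axes m q}

theorem sampleMean_coe (n : ℕ) (y : ℕ → Axes m q) :
    (sampleMean n y).1.ofLp = (n : ℝ)⁻¹ • ∑ r ∈ Finset.range n, (embed (y r)).1.ofLp := by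
  rw [sampleMean]
  simp

/-- The perturbation `((J_s - μ_s) γ_s)_s`. -/
noncomputable def perturbation (A₀ : SymTuple m q) (γ : Fin q → Vec m) (A : SymTuple m q) :
    Fin q × Fin (m + 1) → ℝ :=
  fun k => op (A - A₀) k.1 (γ k.1) k.2

/-- The quadratic form with the limiting weights is asymptotically `χ²`. -/
theorem tendsto_tail_limit_form (hm : 1 ≤ m) (hq : 1 ≤ q) (hY : ∀ r, Measurable (Y r))
    (hindep : iIndepFun Y P) (hident : ∀ r, IdentDistrib (Y r) (Y 0) P P)
    {d : Fin q → Fin (m + 1) → ℝ} {g : Fin q → Fin (m + 1) → Vec m}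
    (h : IsEigenFrame (meanEmbed P (Y 0)) d g)
    (hpos : (frameCov (Matrix.of (secondMoment P Y)) d g).PosDef) (t : ℝ) :
    Tendsto (fun n : ℕ => P.real {ω | t < n *
      (perturbation (meanEmbed P (Y 0)) (fun s => g s (Fin.last m))
          (sampleMean n fun r => Y r ω) ⬝ᵥ
        (weightMat (fun s => d s (Fin.last m)) (Matrix.of (secondMoment P Y)) d g *ᵥ
          perturbation (meanEmbed P (Y 0)) (fun s => g s (Fin.last m))
            (sampleMean n fun r => Y r ω)))}) atTop (𝓝 (chiSquaredTail (m * q) t)) := by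
  obtain ⟨B, hB, hB1⟩ := exists_whitening hpos
  set F := frameMat d g with hF
  set K := Matrix.of (secondMoment P Y) with hK
  -- Whitened tangent coordinates: mean zero by the eigenvector relations and identity covariance by
  -- the choice of `B`.
  let ζ' : Axes m q → EuclideanSpace ℝ (Fin q × Fin m) :=
    fun p => WithLp.toLp 2 (B *ᵥ (Fᵀ *ᵥ (embed p).1.ofLp))
  have hent : Measurable fun p : Axes m q => (embed p).1.ofLp :=
    measurable_pi_lambda _ fun k => measurable_embed_apply k
  have hζ' : Measurable ζ' := by
    refine (WithLp.measurable_toLp 2 _).comp ?_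
    have h1 : Continuous fun v : EntryIdx m q → ℝ => B *ᵥ (Fᵀ *ᵥ v) := by fun_prop
    exact h1.measurable.comp hent
  have hinner : ∀ (p : Axes m q) (t : EuclideanSpace ℝ (Fin q × Fin m)),
      ⟪ζ' p, t⟫ = (F *ᵥ (Bᵀ *ᵥ t.ofLp)) ⬝ᵥ (embed p).1.ofLp := by
    intro p t
    rw [EuclideanSpace.inner_eq_star_dotProduct, star_trivial]
    simp only [ζ']
    rw [Matrix.dotProduct_mulVec, Matrix.dotProduct_mulVec, ← Matrix.mulVec_transpose,
      ← Matrix.mulVec_transpose, Matrix.transpose_transpose]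
  have hfin : Module.finrank ℝ (EuclideanSpace ℝ (Fin q × Fin m)) = m * q := by
    simp [mul_comm]
  have hclt := tendsto_tail_normalizedSum (P := P) (ζ := fun r ω => ζ' (Y r ω))
    (fun r => hζ'.comp (hY r)) (hindep.comp (fun _ => ζ') fun _ => hζ')
    (fun r => (hident r).comp hζ') (fun t => by
      simp only [hinner]
      rw [integral_dotProduct_embed hY, dotProduct_comm, Matrix.dotProduct_mulVec,
        ← Matrix.mulVec_transpose, frameMat_transpose_mulVec_self h, zero_dotProduct])
    (fun t => by
      simp only [hinner, sq]
      rw [integral_dotProduct_mul_dotProduct hY, ← sq, EuclideanSpace.real_norm_sq_eq]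
      set z := t.ofLp with hz
      have h1 : (F *ᵥ (Bᵀ *ᵥ z)) ⬝ᵥ (K *ᵥ (F *ᵥ (Bᵀ *ᵥ z))) =
          z ⬝ᵥ ((B * (Fᵀ * K * F) * Bᵀ) *ᵥ z) := by
        simp only [Matrix.mulVec_mulVec, Matrix.dotProduct_mulVec, Matrix.vecMul_mulVec,
          Matrix.transpose_mul, Matrix.transpose_transpose, Matrix.mul_assoc]
      rw [h1]
      change z ⬝ᵥ ((B * frameCov K d g * Bᵀ) *ᵥ z) = _
      rw [hB1, Matrix.one_mulVec]
      simp [dotProduct, sq])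
    (by rw [hfin]; positivity) t
  rw [hfin] at hclt
  refine hclt.congr fun n => ?_
  congr 1
  ext ω
  simp only [Set.mem_ofPred_eq]
  set A := sampleMean n fun r => Y r ω with hA
  set u := perturbation (meanEmbed P (Y 0)) (fun s => g s (Fin.last m)) A with hu
  -- In the population frame, contracting the perturbation reproduces the tangent coordinates of
  -- `A`, those of the mean being zero.
  have hWu : (resolventMat (fun s => d s (Fin.last m)) d g)ᵀ *ᵥ u = Fᵀ *ᵥ A.1.ofLp := by
    have h1 : (resolventMat (fun s => d s (Fin.last m)) d g)ᵀ *ᵥ u =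
        Fᵀ *ᵥ (A - meanEmbed P (Y 0)).1.ofLp := by
      funext sa
      rw [hF, frameMat_transpose_mulVec]
      exact resolventMat_transpose_mulVec _ d g
        (fun s => op (A - meanEmbed P (Y 0)) s (g s (Fin.last m))) sa
    rw [h1, Submodule.coe_sub, WithLp.ofLp_sub, Matrix.mulVec_sub,
      frameMat_transpose_mulVec_self h, sub_zero]
  have hsum : ∑ k ∈ Finset.range n, ζ' (Y k ω) =
      (n : ℝ) • WithLp.toLp 2 (B *ᵥ (Fᵀ *ᵥ A.1.ofLp)) := by
    rcases eq_or_ne n 0 with rfl | hn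
    · simp
    · have hn' : (n : ℝ) ≠ 0 := Nat.cast_ne_zero.2 hn
      rw [hA, sampleMean_coe, Matrix.mulVec_smul, Matrix.mulVec_smul, WithLp.toLp_smul, smul_smul,
        mul_inv_cancel₀ hn', one_smul, Matrix.mulVec_sum, Matrix.mulVec_sum, WithLp.toLp_sum]
  have hquad : u ⬝ᵥ (weightMat (fun s => d s (Fin.last m)) K d g *ᵥ u) =
      ‖(WithLp.toLp 2 (B *ᵥ (Fᵀ *ᵥ A.1.ofLp)) : EuclideanSpace ℝ (Fin q × Fin m))‖ ^ 2 := by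
    rw [← hWu, weightMat, hB]
    set W := resolventMat (fun s => d s (Fin.last m)) d g
    rw [EuclideanSpace.real_norm_sq_eq]
    have h1 : u ⬝ᵥ ((W * (Bᵀ * B) * Wᵀ) *ᵥ u) =
        (B *ᵥ (Wᵀ *ᵥ u)) ⬝ᵥ (B *ᵥ (Wᵀ *ᵥ u)) := by
      simp only [Matrix.mulVec_mulVec, Matrix.dotProduct_mulVec, Matrix.vecMul_mulVec,
        Matrix.transpose_mul, Matrix.transpose_transpose, Matrix.mul_assoc]
    rw [h1]
    simp [dotProduct, sq]
  rw [hquad, hsum, norm_smul, norm_smul, mul_pow, mul_pow, ← mul_assoc, norm_inv, inv_pow,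
    Real.norm_of_nonneg (Real.sqrt_nonneg _), Real.sq_sqrt (Nat.cast_nonneg n),
    Real.norm_of_nonneg (Nat.cast_nonneg n)]
  rcases eq_or_ne n 0 with rfl | hn
  · simp
  · have hn' : (n : ℝ) ≠ 0 := Nat.cast_ne_zero.2 hn
    rw [sq (n : ℝ), inv_mul_cancel_left₀ hn']

/-- The entries of `(A_s γ_s)_s` as functionals of `A`. -/
noncomputable def opCoord (γ : Fin q → Vec m) (k : Fin q × Fin (m + 1)) : SymTuple m q →L[ℝ] ℝ :=
  LinearMap.toContinuousLinearMap
    ((EuclideanSpace.proj k.2 : Vec m →L[ℝ] ℝ).toLinearMap ∘ₗ opAt k.1 (γ k.1))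

theorem perturbation_eq (A₀ : SymTuple m q) (γ : Fin q → Vec m) (A : SymTuple m q)
    (k : Fin q × Fin (m + 1)) : perturbation A₀ γ A k = opCoord γ k (A - A₀) := rfl

theorem measurable_perturbation_embed (A₀ : SymTuple m q) (γ : Fin q → Vec m)
    (k : Fin q × Fin (m + 1)) : Measurable fun p : Axes m q => perturbation A₀ γ (embed p) k := by
  simp only [perturbation_eq, map_sub]
  exact ((opCoord γ k).continuous.measurable.comp measurable_embed).sub measurable_const

theorem exists_abs_perturbation_embed_le (A₀ : SymTuple m q) (γ : Fin q → Vec m)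
    (k : Fin q × Fin (m + 1)) : ∃ C, ∀ p : Axes m q, |perturbation A₀ γ (embed p) k| ≤ C := by
  refine ⟨‖opCoord γ k‖ * (√q + ‖A₀‖), fun p => ?_⟩
  have h1 := (opCoord γ k).le_opNorm (embed p - A₀)
  have h2 : ‖embed p - A₀‖ ≤ √q + ‖A₀‖ := by
    refine (norm_sub_le _ _).trans_eq ?_
    rw [← norm_embed_sq p, Real.sqrt_sq (norm_nonneg _)]
  exact h1.trans (mul_le_mul_of_nonneg_left h2 (ContinuousLinearMap.opNorm_nonneg _))

theorem integral_perturbation_embed (hY : ∀ r, Measurable (Y r)) (γ : Fin q → Vec m)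
    (k : Fin q × Fin (m + 1)) :
    ∫ ω, perturbation (meanEmbed P (Y 0)) γ (embed (Y 0 ω)) k ∂P = 0 := by
  have hint : Integrable (fun ω => embed (Y 0 ω)) P := (integrable_moments hY).fst
  refine ((opCoord γ k).integral_comp_comm (φ := fun ω => embed (Y 0 ω) - meanEmbed P (Y 0))
    (hint.sub (integrable_const _))).trans ?_
  rw [integral_sub hint (integrable_const _)]
  simp [meanEmbed]

/-- For `n = 0` the sample mean is `0` and the left side need not vanish, whence the restriction. -/
theorem perturbation_sampleMean {n : ℕ} (hn : n ≠ 0) (A₀ : SymTuple m q) (γ : Fin q → Vec m)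
    (y : ℕ → Axes m q) (k : Fin q × Fin (m + 1)) :
    perturbation A₀ γ (sampleMean n y) k =
      (n : ℝ)⁻¹ * ∑ r ∈ Finset.range n, perturbation A₀ γ (embed (y r)) k := by
  have hn' : (n : ℝ) ≠ 0 := Nat.cast_ne_zero.2 hn
  simp only [perturbation_eq]
  rw [← map_sum, ← smul_eq_mul, ← map_smul, Finset.sum_sub_distrib, smul_sub, sampleMean,
    Finset.sum_const, Finset.card_range, ← Nat.cast_smul_eq_nsmul ℝ, inv_smul_smul₀ hn']

/-- The normalized perturbations are bounded in probability. -/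
theorem exists_measure_perturbation_sq_le (hY : ∀ r, Measurable (Y r)) (hindep : iIndepFun Y P)
    (hident : ∀ r, IdentDistrib (Y r) (Y 0) P P) (γ : Fin q → Vec m) :
    ∃ C, ∀ ε > 0, ∀ n : ℕ, n ≠ 0 → P.real {ω | ε ≤ n * ∑ k,
      perturbation (meanEmbed P (Y 0)) γ (sampleMean n fun r => Y r ω) k ^ 2} ≤ C / ε := by
  choose C hC using exists_abs_perturbation_embed_le (meanEmbed P (Y 0)) γ
  have hmeas := measurable_perturbation_embed (meanEmbed P (Y 0)) γ
  refine ⟨∑ k, C k ^ 2, fun ε hε n hn => ?_⟩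
  have hsq := fun k => integrable_scaled_average_sq (P := P) hY (hmeas k) (hC k) n
  have hmk := mul_meas_ge_le_integral_of_nonneg (μ := P)
    (f := fun ω => ∑ k, (n : ℝ) * ((n : ℝ)⁻¹ * ∑ r ∈ Finset.range n,
      perturbation (meanEmbed P (Y 0)) γ (embed (Y r ω)) k) ^ 2)
    (.of_forall fun ω => Finset.sum_nonneg fun k _ => by positivity)
    (integrable_finsetSum _ fun k _ => hsq k) ε
  rw [integral_finsetSum _ fun k _ => hsq k] at hmk
  simp only [perturbation_sampleMean hn]
  rw [le_div_iff₀' hε]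
  simp only [← Finset.mul_sum] at hmk ⊢
  exact hmk.trans (Finset.sum_le_sum fun k _ => integral_scaled_average_sq_le hY hindep hident
    (hmeas k) (hC k) (integral_perturbation_embed hY γ k) n)

/-- The difference is at most `δ (∑ |u_k|)²`; Cauchy–Schwarz then gives the factor `card ι`. -/
theorem abs_quadratic_sub_le {ι : Type*} [Fintype ι] (u : ι → ℝ) (Q Q' : Matrix ι ι ℝ) {δ : ℝ}
    (h : ∀ k l, |Q k l - Q' k l| ≤ δ) :
    |u ⬝ᵥ (Q *ᵥ u) - u ⬝ᵥ (Q' *ᵥ u)| ≤ δ * (Fintype.card ι * ∑ k, u k ^ 2) := by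
  have h1 : u ⬝ᵥ (Q *ᵥ u) - u ⬝ᵥ (Q' *ᵥ u) = ∑ k, ∑ l, (Q k l - Q' k l) * (u k * u l) := by
    rw [← dotProduct_sub, ← Matrix.sub_mulVec]
    simp only [dotProduct, Matrix.mulVec, Matrix.sub_apply, Finset.mul_sum]
    refine Finset.sum_congr rfl fun k _ => Finset.sum_congr rfl fun l _ => by ring
  rw [h1]
  rcases isEmpty_or_nonempty ι with hι | ⟨⟨i⟩⟩
  · simp
  have hδ : 0 ≤ δ := (abs_nonneg _).trans (h i i)
  calc |∑ k, ∑ l, (Q k l - Q' k l) * (u k * u l)|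
      ≤ ∑ k, ∑ l, δ * (|u k| * |u l|) := by
        refine (Finset.abs_sum_le_sum_abs _ _).trans (Finset.sum_le_sum fun k _ =>
          (Finset.abs_sum_le_sum_abs _ _).trans (Finset.sum_le_sum fun l _ => ?_))
        rw [abs_mul, abs_mul]
        exact mul_le_mul_of_nonneg_right (h k l) (by positivity)
    _ = δ * (∑ k, |u k|) ^ 2 := by
        rw [sq, Finset.sum_mul_sum]; simp only [Finset.mul_sum]
    _ ≤ δ * (Fintype.card ι * ∑ k, u k ^ 2) := by
        refine mul_le_mul_of_nonneg_left ?_ hδ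
        simpa using sq_sum_le_card_mul_sum_sq (s := Finset.univ) (f := fun k => |u k|)

theorem average_moments (n : ℕ) (y : ℕ → Axes m q) :
    (n : ℝ)⁻¹ • ∑ r ∈ Finset.range n, moments (y r) =
      (sampleMean n y, ((n : ℝ)⁻¹ • ∑ r ∈ Finset.range n, outer (y r) :
        Matrix (EntryIdx m q) (EntryIdx m q) ℝ)) := by
  refine Prod.ext ?_ ?_
  · simp [sampleMean, moments, Prod.fst_sum]
  · funext k l
    simp [moments, Prod.snd_sum, outer, Matrix.sum_apply, Matrix.vecMulVec_apply]

end Limits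

/-! ### Replacing the sample weights by their limit. -/

section Main

variable {Ω : Type*} [MeasurableSpace Ω] {P : Measure Ω} [IsProbabilityMeasure P]
  {Y : ℕ → Ω → Axes m q} {X : ℕ → Ω → Fin q → Vec m}
  {d : ℕ → Ω → Fin q → Fin (m + 1) → ℝ} {g : ℕ → Ω → Fin q → Fin (m + 1) → Vec m}

theorem tendsto_moments_notMem (hY : ∀ r, Measurable (Y r)) (hindep : iIndepFun Y P)
    (hident : ∀ r, IdentDistrib (Y r) (Y 0) P P)
    {U : SymTuple m q × (EntryIdx m q → EntryIdx m q → ℝ) → Prop}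
    (hU : ∀ᶠ x in 𝓝 (meanEmbed P (Y 0), secondMoment P Y), U x) :
    Tendsto (fun n : ℕ => P.real {ω | ¬ U (sampleMean n (fun r => Y r ω),
      ((n : ℝ)⁻¹ • ∑ r ∈ Finset.range n, outer (Y r ω) :
        Matrix (EntryIdx m q) (EntryIdx m q) ℝ))}) atTop (𝓝 0) := by
  rw [← integral_moments hY] at hU
  refine (tendsto_average_notMem hY hindep hident measurable_moments norm_moments_le hU).congr
    fun n => ?_
  congr 1
  ext ω
  rw [Set.mem_ofPred_eq, average_moments]
  rfl

/-- The Hotelling statistic differs from the limiting quadratic form by a term tending to zero in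
outer probability. -/
theorem tendsto_hotelling_sub (hY : ∀ r, Measurable (Y r))
    (hindep : iIndepFun Y P) (hident : ∀ r, IdentDistrib (Y r) (Y 0) P P)
    (hX : ∀ r ω s, IsUnitRep (X r ω s) (Y r ω s)) (hA : Nonfocal (meanEmbed P (Y 0)))
    {d₀ : Fin q → Fin (m + 1) → ℝ} {g₀ : Fin q → Fin (m + 1) → Vec m}
    (h₀ : IsEigenFrame (meanEmbed P (Y 0)) d₀ g₀)
    (hpos : (frameCov (Matrix.of (secondMoment P Y)) d₀ g₀).PosDef)
    (hg : ∀ n ω, IsEigenFrame (sampleMean n fun r => Y r ω) (d n ω) (g n ω))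
    (hsign : ∀ n ω s, 0 ≤ ⟪g₀ s (Fin.last m), g n ω s (Fin.last m)⟫) {ε : ℝ} (hε : 0 < ε) :
    Tendsto (fun n : ℕ => P.real {ω | ε ≤
      |hotelling n (fun r => X r ω) (d n ω) (g n ω) (fun s => g₀ s (Fin.last m)) - n *
      (perturbation (meanEmbed P (Y 0)) (fun s => g₀ s (Fin.last m))
          (sampleMean n fun r => Y r ω) ⬝ᵥ
        (weightMat (fun s => d₀ s (Fin.last m)) (Matrix.of (secondMoment P Y)) d₀ g₀ *ᵥ
          perturbation (meanEmbed P (Y 0)) (fun s => g₀ s (Fin.last m))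
            (sampleMean n fun r => Y r ω)))|}) atTop (𝓝 0) := by
  set γ : Fin q → Vec m := fun s => g₀ s (Fin.last m) with hγ
  obtain ⟨C, hC⟩ := exists_measure_perturbation_sq_le hY hindep hident γ
  rw [tendsto_order]
  refine ⟨fun a ha => .of_forall fun n => ha.trans_le measureReal_nonneg, fun η hη => ?_⟩
  set N : ℝ := (Fintype.card (Fin q × Fin (m + 1)) : ℝ) with hN
  have hN0 : 0 ≤ N := Nat.cast_nonneg _
  -- `R` makes the Markov bound `C / R` smaller than `η / 2`; the `+ 1` keeps `R` positive. Below,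
  -- `δ` is chosen so that `δ N R < ε`.
  set R : ℝ := 2 * (|C| + 1) / η with hR
  have hRpos : 0 < R := by positivity
  have hCR : C / R < η / 2 + η / 2 - η / 2 := by
    rw [hR, div_div_eq_mul_div, div_lt_iff₀ (by positivity)]
    nlinarith [le_abs_self C, abs_nonneg C]
  set δ : ℝ := ε / (2 * (N + 1) * R) with hδ
  have hδpos : 0 < δ := by positivity
  have hbad := tendsto_moments_notMem hY hindep hident
    (eventually_weightMat_close hA h₀ hpos hδpos)
  filter_upwards [hbad.eventually (gt_mem_nhds (show (0 : ℝ) < η / 2 by linarith)),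
    eventually_ne_atTop 0] with n hn hn0
  refine lt_of_le_of_lt ((measureReal_mono ?_).trans (measureReal_union_le _ _))
    (add_lt_add hn (lt_of_le_of_lt (hC R hRpos n hn0) hCR) |>.trans_eq (by ring))
  intro ω hω
  by_contra hcon
  rw [Set.mem_union, not_or] at hcon
  obtain ⟨h1, h2⟩ := hcon
  simp only [Set.mem_ofPred_eq, not_not] at h1
  simp only [Set.mem_ofPred_eq, not_le] at h2
  obtain ⟨hne, hclose⟩ := h1 (d n ω) (g n ω) (hg n ω) (hsign n ω)
  have hsc := sampleCov_eq n (fun r => Y r ω) (fun r => X r ω) (fun r s => hX r ω s) (d n ω) (g n ω)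
  have hhot := hotelling_eq h₀ (hg n ω) hne n (fun r => X r ω) hsc
  have hω' : ε ≤ _ := hω
  rw [hhot, ← mul_sub, abs_mul, Nat.abs_cast] at hω'
  set u := perturbation (meanEmbed P (Y 0)) γ (sampleMean n fun r => Y r ω) with hu
  have hb := abs_quadratic_sub_le u _ _ fun k l => (hclose k l).le
  have hle : ε ≤ δ * N * (n * ∑ k, u k ^ 2) := by
    refine hω'.trans ((mul_le_mul_of_nonneg_left hb (Nat.cast_nonneg n)).trans_eq ?_)
    ring
  have hlt : δ * N * (n * ∑ k, u k ^ 2) ≤ δ * N * R :=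
    mul_le_mul_of_nonneg_left h2.le (by positivity)
  have hfin : δ * N * R < ε := by
    have : δ * (2 * (N + 1) * R) = ε := by rw [hδ]; field_simp
    nlinarith [mul_pos hδpos hRpos]
  linarith

end Main

end ProjShape

/-! ### The large sample p-value. -/

theorem corollary4p3 {m q : ℕ} (hm : 1 ≤ m) (hq : 1 ≤ q)
    {Ω : Type*} [MeasurableSpace Ω] (P : Measure Ω) [IsProbabilityMeasure P]
    -- an i.i.d. sequence of random projective shapes `Y_r = ([X_r^1], …, [X_r^q])`
    (Y : ℕ → Ω → Axes m q) (hY : ∀ r, Measurable (Y r))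
    (hindep : iIndepFun Y P) (hident : ∀ r, IdentDistrib (Y r) (Y 0) P P)
    (X : ℕ → Ω → Fin q → Vec m) (hX : ∀ r ω s, IsUnitRep (X r ω s) (Y r ω s))
    -- `Y_1` is nonfocal and its extrinsic covariance matrix is positive definite
    (hfocal : Nonfocal (meanEmbed P (Y 0)))
    (lam : Fin q → Fin (m + 1) → ℝ) (gam : Fin q → Fin (m + 1) → Vec m)
    (hgam : IsEigenFrame (meanEmbed P (Y 0)) lam gam)
    (hcov : (extrinsicCov P (Y 0) gam).PosDef)
    -- the hypothesized mean `μ₀ = ([γ_1], …, [γ_q])`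
    (μ₀ : Axes m q) (γ₀ : Fin q → Vec m) (hγ₀ : ∀ s, IsUnitRep (γ₀ s) (μ₀ s))
    -- eigenvalues and eigenvectors of the sample means, oriented along `γ₀`
    (d : ℕ → Ω → Fin q → Fin (m + 1) → ℝ) (g : ℕ → Ω → Fin q → Fin (m + 1) → Vec m)
    (hg : ∀ n ω, IsEigenFrame (sampleMean n fun r => Y r ω) (d n ω) (g n ω))
    (hsign : ∀ n ω s, 0 ≤ inner ℝ (γ₀ s) (g n ω s (Fin.last m)))
    -- the statistic `T(Ȳ_n; μ₀)` and the p-value `Pr (T > T(Ȳ_n; μ₀))`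
    (T : ℕ → Ω → ℝ)
    (hT : ∀ n ω, T n ω = hotelling n (fun r => X r ω) (d n ω) (g n ω) γ₀)
    (p : ℕ → Ω → ℝ) (hp : ∀ n ω, p n ω = chiSquaredTail (m * q) (T n ω)) :
    -- under `H₀`
    (nearest (meanEmbed P (Y 0)) hfocal = μ₀ →
      TendstoUniformly (fun n t => P.real {ω | t < T n ω}) (chiSquaredTail (m * q)) atTop ∧
      ∀ α ∈ Set.Icc (0 : ℝ) 1, Tendsto (fun n => P.real {ω | p n ω ≤ α}) atTop (𝓝 α)) ∧
    -- under `H₁`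
    (nearest (meanEmbed P (Y 0)) hfocal ≠ μ₀ →
      ∀ α : ℝ, 0 < α → Tendsto (fun n => P.real {ω | p n ω ≤ α}) atTop (𝓝 1)) := by
  have hN : m * q ≠ 0 := by positivity
  have hcont := chiSquaredTail_continuous hN
  have hanti := chiSquaredTail_antitone (m * q)
  have hbot := chiSquaredTail_tendsto_atBot (m * q)
  have htop := chiSquaredTail_tendsto_atTop (m * q)
  have hpos := frameCov_posDef_of_extrinsicCov hm hq hY hgam hfocal hcov
  constructor
  · intro hμ
    -- The given population frame may have leading vectors `-γ₀ s`; the signs are changed to match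
    -- the orientation of the sample frames.
    obtain ⟨g₀, h₀, hlast⟩ := exists_isEigenFrame_last hfocal hgam (γ₀ := γ₀)
      (fun s => by rw [hμ]; exact hγ₀ s)
    subst hlast
    have hlim : ∀ t, Tendsto (fun n => P.real {ω | t < T n ω}) atTop
        (𝓝 (chiSquaredTail (m * q) t)) := by
      have hpos₀ := frameCov_posDef hfocal hgam h₀ hpos
      refine tendsto_tail_of_tendsto_sub hcont
        (tendsto_tail_limit_form hm hq hY hindep hident h₀ hpos₀) fun ε hε => ?_
      simp only [hT]
      exact tendsto_hotelling_sub hY hindep hident hX hfocal h₀ hpos₀ hg hsign hε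
    refine ⟨tendstoUniformly_of_tail (fun n s t hst => measureReal_mono fun ω hω =>
      hst.trans_lt hω) (fun n t => measureReal_nonneg) (fun n t => measureReal_le_one) hcont hanti
      hbot htop hlim, fun α hα => ?_⟩
    simp only [hp]
    exact tendsto_pvalue hcont hanti hbot htop hlim hα
  · intro hμ α hα
    obtain ⟨c, hc, hev⟩ := exists_eventually_lt_hotelling hfocal hgam hpos hγ₀ hμ
    have hbad := tendsto_moments_notMem hY hindep hident hev
    -- Beyond `t₀` the tail is below `α`, and the lower bound `n c` of the statistic eventually
    -- exceeds `t₀`.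
    obtain ⟨t₀, ht₀⟩ := (htop.eventually (gt_mem_nhds hα)).exists
    have hgrow : ∀ᶠ n : ℕ in atTop, t₀ ≤ n * c :=
      (tendsto_natCast_atTop_atTop.atTop_mul_const hc).eventually_ge_atTop t₀
    have hlow := hbad.const_sub 1
    rw [sub_zero] at hlow
    refine tendsto_of_tendsto_of_tendsto_of_le_of_le' hlow tendsto_const_nhds ?_
      (.of_forall fun n => measureReal_le_one)
    filter_upwards [hgrow] with n hn
    rw [sub_le_iff_le_add, ← probReal_univ (μ := P)]
    refine (measureReal_mono fun ω _ => ?_).trans (measureReal_union_le _ _)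
    by_contra hcon
    rw [Set.mem_union, not_or] at hcon
    obtain ⟨h1, h2⟩ := hcon
    simp only [Set.mem_ofPred_eq, not_not] at h2
    have h3 := h2 (d n ω) (g n ω) (hg n ω) (hsign n ω)
    refine h1 ?_
    rw [Set.mem_ofPred_eq, hp]
    refine (hanti ?_).trans ht₀.le
    rw [hT, hotelling, sampleCov_eq n (fun r => Y r ω) (fun r => X r ω) fun r s => hX r ω s]
    exact hn.trans (mul_le_mul_of_nonneg_left h3.le (Nat.cast_nonneg n))
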